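/- Let $B>0$ and $\mu\ge B$. On $\mathrm L^2(\mathbb R^2)$ let $\mathrm H=(-\mathrm i\nabla-a)^2$ be the (self-adjoint) Landau Hamiltonian with vector potential $a(x)=\frac B2\,(x_2,-x_1)$, and let $\Theta(\mu\mathbb 1-\mathrm H)$ be its Fermi projection, that is, the spectral projection of $\mathrm H$ for the half-line $(-\infty,\mu]$. For $\alpha>0$ define the Rényi entropy function on $[0,1]$ by $$h_\alpha(t)=\frac1{1-\alpha}\ln\big(t^\alpha+(1-t)^\alpha\big)\quad(\alpha\ne1),\qquad h_1(t)=-t\ln t-(1-t)\ln(1-t),\quad h_1(0)=h_1(1)=0.$$ For a Borel set $\Lambda\subset\mathbb R^2$ let $\mathbb 1_\Lambda$ denote the operator of multiplication by its indicator function, and define the local $\alpha$-Rényi ground-state entropy $$S_\alpha(\Lambda):=\operatorname{tr}\,h_\alpha\big(\mathbb 1_\Lambda\,\Theta(\mu\mathbb 1-\mathrm H)\,\mathbb 1_\Lambda\big)\in[0,\infty],$$ the trace of a positive bounded operator on $\mathrm L^2(\mathbb R^2)$. **Lemma.** For every bounded Borel set $\Lambda\subset\mathbb R^2$ and every $\alpha>0$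 one has $S_\alpha(\Lambda)<\infty$. -/

import Mathlib

open MeasureTheory
open scoped ENNReal ContDiff InnerProductSpace

noncomputable section

namespace LandauEntropy

/-! ### Abstract Hilbert space notions -/

section Abstract

variable {H : Type*} [NormedAddCommGroup H] [InnerProductSpace ℂ H]

/-- The closed subspace `V` (with orthogonal projection `Q`) reduces the unbounded operator `A`:
`Q` maps the domain of `A` into itself and `A Q u = Q A u` for all `u` in the domain of `A`. -/
def Reduces (A : H →ₗ.[ℂ] H) (V : Submodule ℂ H) [V.HasOrthogonalProjection] : Prop :=
  ∀ u v : H, (u, v) ∈ A.graph → (V.starProjection u, V.starProjection v) ∈ A.graph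

/-- `A ≤ c` on `V` in the sense of quadratic forms. -/
def FormBoundedAboveOn (A : H →ₗ.[ℂ] H) (V : Submodule ℂ H) (c : ℝ) : Prop :=
  ∀ u : A.domain, (u : H) ∈ V → (⟪(u : H), A u⟫_ℂ).re ≤ c * ‖(u : H)‖ ^ 2

lemma tsum_ofReal_inner_sq {ι : Type*} (b : HilbertBasis ι ℂ H) (x : H) :
    ∑' i, ENNReal.ofReal (‖⟪b i, x⟫_ℂ‖ ^ 2) = ENNReal.ofReal (‖x‖ ^ 2) := by
  have h := b.hasSum_inner_mul_inner x x
  have h' : HasSum (fun i => ‖⟪b i, x⟫_ℂ‖ ^ 2) (‖x‖ ^ 2) := by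
    have h2 := Complex.reCLM.hasSum h
    have e : Complex.reCLM ⟪x, x⟫_ℂ = ‖x‖ ^ 2 := by
      rw [Complex.reCLM_apply, inner_self_eq_norm_sq_to_K]
      norm_cast
    rw [e] at h2
    refine h2.congr_fun ?_ |> id
    intro i
    simp only [Complex.reCLM_apply]
    rw [← inner_conj_symm x (b i), Complex.conj_mul']
    norm_cast
  rw [← ENNReal.ofReal_tsum_of_nonneg (fun _ => by positivity) h'.summable, h'.tsum_eq]

variable [CompleteSpace H]

/-- For a self-adjoint operator `A`, the spectral subspace of `A` for the half-line `(-∞, c]`, that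
is, the range of the spectral projection `𝟙_{(-∞, c]}(A) = Θ(c 𝟙 - A)`. It is the largest closed
subspace which reduces `A` and on which `A ≤ c`: the range of the spectral projection has these
two properties, and if `V` has them, then the part of `A` in `V` is self-adjoint with
spectrum in `(-∞, c]`, so that `Θ(c 𝟙 - A)` acts on `V` as the identity.
It is written as the closed linear span of all such `V`. -/
def spectralSubspace (A : H →ₗ.[ℂ] H) (c : ℝ) : Submodule ℂ H :=
  (sSup {V : Submodule ℂ H | ∃ _ : V.HasOrthogonalProjection,
    Reduces A V ∧ FormBoundedAboveOn A V c}).topologicalClosure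

instance (A : H →ₗ.[ℂ] H) (c : ℝ) : CompleteSpace (spectralSubspace A c) :=
  (Submodule.isClosed_topologicalClosure _).completeSpace_coe

/-- The spectral projection `Θ(c 𝟙 - A)` of a self-adjoint operator `A`, where `Θ` is Heaviside's
unit-step function with `Θ(0) = 1`. -/
def spectralProjection (A : H →ₗ.[ℂ] H) (c : ℝ) : H →L[ℂ] H :=
  (spectralSubspace A c).starProjection

/-- The trace, with values in `[0, ∞]`, of a positive bounded operator `T`: the sum of the diagonal
entries of `T` in an orthonormal basis. See `posTrace_eq` for the independence of the basis. -/
def posTrace (T : H →L[ℂ] H) : ℝ≥0∞ :=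
  ∑' i, ENNReal.ofReal
    (⟪(exists_hilbertBasis ℂ H).choose_spec.choose i,
      T ((exists_hilbertBasis ℂ H).choose_spec.choose i)⟫_ℂ).re

lemma tsum_diag_eq {ι κ : Type*} (b : HilbertBasis ι ℂ H) (c : HilbertBasis κ ℂ H)
    {T : H →L[ℂ] H} (hT : 0 ≤ T) :
    ∑' i, ENNReal.ofReal (⟪b i, T (b i)⟫_ℂ).re = ∑' j, ENNReal.ofReal (⟪c j, T (c j)⟫_ℂ).re := by
  set S := CFC.sqrt T with hS
  have hSS : S * S = T := CFC.sqrt_mul_sqrt_self T hT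
  have hSa : IsSelfAdjoint S := (CFC.sqrt_nonneg T).isSelfAdjoint
  have hsym : ∀ x y : H, ⟪S x, y⟫_ℂ = ⟪x, S y⟫_ℂ := fun x y =>
    (ContinuousLinearMap.isSelfAdjoint_iff_isSymmetric.mp hSa) x y
  have key : ∀ x : H, (⟪x, T x⟫_ℂ).re = ‖S x‖ ^ 2 := by
    intro x
    rw [← hSS, mul_apply_eq_comp, ← hsym, inner_self_eq_norm_sq_to_K]
    norm_cast
  simp only [key]
  simp only [← tsum_ofReal_inner_sq c (S (b _)), ← tsum_ofReal_inner_sq b (S (c _))]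
  rw [ENNReal.tsum_comm]
  congr! 6 with j i
  rw [← hsym, norm_inner_symm]

/-- The trace of a positive operator may be computed in any orthonormal basis. -/
theorem posTrace_eq {ι : Type*} (b : HilbertBasis ι ℂ H) {T : H →L[ℂ] H} (hT : 0 ≤ T) :
    posTrace T = ∑' i, ENNReal.ofReal (⟪b i, T (b i)⟫_ℂ).re :=
  tsum_diag_eq _ b hT

end Abstract

/-! ### The Landau Hamiltonian -/

/-- The Euclidean plane. -/
abbrev Plane : Type := EuclideanSpace ℝ (Fin 2)

/-- The single-particle Hilbert space `L²(ℝ²)`. -/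
abbrev L2 : Type := Lp ℂ 2 (volume : Measure Plane)

/-- The vector potential `a(x) = (x₂, -x₁) B / 2` (symmetric gauge). -/
def vecPot (B : ℝ) (j : Fin 2) (x : Plane) : ℝ :=
  if j = 0 then x 1 * (B / 2) else -x 0 * (B / 2)

/-- The `j`-th component of `-i∇ - a`, acting on functions. -/
def momentum (B : ℝ) (j : Fin 2) (ψ : Plane → ℂ) (x : Plane) : ℂ :=
  -Complex.I * fderiv ℝ ψ x (EuclideanSpace.single j 1) - (vecPot B j x : ℂ) * ψ x

/-- The differential expression `(-i∇ - a)²`, acting on functions. -/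
def landauExpr (B : ℝ) (ψ : Plane → ℂ) (x : Plane) : ℂ :=
  ∑ j : Fin 2, momentum B j (momentum B j ψ) x

lemma contDiff_vecPot (B : ℝ) (j : Fin 2) : ContDiff ℝ ∞ (fun x => (vecPot B j x : ℂ)) := by
  have h : ContDiff ℝ ∞ (vecPot B j) := by
    by_cases h : j = 0
    · have e : vecPot B j = fun x => x 1 * (B / 2) := by
        funext x
        simp [vecPot, h]
      rw [e]
      fun_prop
    · have e : vecPot B j = fun x => -x 0 * (B / 2) := by
        funext x
        simp [vecPot, h]
      rw [e]
      fun_prop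
  exact Complex.ofRealCLM.contDiff.comp (g := Complex.ofRealCLM) h

lemma contDiff_momentum (B : ℝ) (j : Fin 2) {ψ : Plane → ℂ} (hψ : ContDiff ℝ ∞ ψ) :
    ContDiff ℝ ∞ (momentum B j ψ) := by
  unfold momentum
  have h1 : ContDiff ℝ ∞ (fun x => fderiv ℝ ψ x (EuclideanSpace.single j 1)) :=
    (hψ.fderiv_right (m := ∞) (by simp)).clm_apply contDiff_const
  exact (contDiff_const.mul h1).sub ((contDiff_vecPot B j).mul hψ)

lemma hasCompactSupport_momentum (B : ℝ) (j : Fin 2) {ψ : Plane → ℂ} (hψ : HasCompactSupport ψ) :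
    HasCompactSupport (momentum B j ψ) := by
  unfold momentum
  exact ((hψ.fderiv_apply (𝕜 := ℝ) _).mul_left (f := fun _ => -Complex.I)).sub hψ.mul_left

lemma memLp_of_smooth {ψ : Plane → ℂ} (h1 : ContDiff ℝ ∞ ψ) (h2 : HasCompactSupport ψ) :
    MemLp ψ 2 (volume : Measure Plane) :=
  h1.continuous.memLp_of_hasCompactSupport h2

lemma memLp_landauExpr (B : ℝ) {ψ : Plane → ℂ} (h1 : ContDiff ℝ ∞ ψ) (h2 : HasCompactSupport ψ) :
    MemLp (landauExpr B ψ) 2 (volume : Measure Plane) := by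
  unfold landauExpr
  refine memLp_finsetSum _ fun j _ => ?_
  exact memLp_of_smooth (contDiff_momentum B j (contDiff_momentum B j h1))
    (hasCompactSupport_momentum B j (hasCompactSupport_momentum B j h2))

/-- `⟨φ, u⟩` for a square integrable function `φ` and `u` in `L²(ℝ²)`. -/
lemma integral_conj_mul {φ : Plane → ℂ} (hφ : MemLp φ 2 (volume : Measure Plane)) (u : L2) :
    ∫ x, starRingEnd ℂ (φ x) * u x = ⟪hφ.toLp φ, u⟫_ℂ := by
  rw [L2.inner_def]
  refine integral_congr_ae ?_
  filter_upwards [hφ.coeFn_toLp] with x hx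
  rw [hx, RCLike.inner_apply, mul_comm]

/-- The graph of the Landau Hamiltonian `(-i∇ - a)²` on its maximal domain: the pairs `(u, v)` of
elements of `L²(ℝ²)` with `(-i∇ - a)² u = v` in the sense of distributions. -/
def landauGraph (B : ℝ) : Submodule ℂ (L2 × L2) where
  carrier := {p | ∀ ψ : Plane → ℂ, ContDiff ℝ ∞ ψ → HasCompactSupport ψ →
    ∫ x, starRingEnd ℂ (landauExpr B ψ x) * p.1 x = ∫ x, starRingEnd ℂ (ψ x) * p.2 x}
  add_mem' := by
    intro p q hp hq ψ h1 h2
    have hp := hp ψ h1 h2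
    have hq := hq ψ h1 h2
    rw [integral_conj_mul (memLp_landauExpr B h1 h2), integral_conj_mul (memLp_of_smooth h1 h2)]
      at hp hq ⊢
    rw [Prod.fst_add, Prod.snd_add, inner_add_right, inner_add_right, hp, hq]
  zero_mem' := by
    intro ψ h1 h2
    rw [integral_conj_mul (memLp_landauExpr B h1 h2), integral_conj_mul (memLp_of_smooth h1 h2)]
    simp
  smul_mem' := by
    intro c p hp ψ h1 h2
    have hp := hp ψ h1 h2
    rw [integral_conj_mul (memLp_landauExpr B h1 h2), integral_conj_mul (memLp_of_smooth h1 h2)]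
      at hp ⊢
    rw [Prod.smul_fst, Prod.smul_snd, inner_smul_right, inner_smul_right, hp]

lemma landauGraph_single_valued (B : ℝ) (p : L2 × L2) (hp : p ∈ landauGraph B)
    (h0 : p.1 = 0) : p.2 = 0 := by
  have hz : ∀ᵐ x ∂(volume : Measure Plane), p.2 x = 0 := by
    refine ae_eq_zero_of_integral_contDiff_smul_eq_zero
      ((Lp.memLp p.2).locallyIntegrable (by norm_num)) fun g hg hgc => ?_
    have h1 : ContDiff ℝ ∞ (fun x => (g x : ℂ)) :=
      Complex.ofRealCLM.contDiff.comp (g := Complex.ofRealCLM) hg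
    have h2 : HasCompactSupport (fun x => (g x : ℂ)) :=
      hgc.comp_left (g := fun t : ℝ => (t : ℂ)) (by simp)
    have h := hp _ h1 h2
    rw [integral_conj_mul (memLp_landauExpr B h1 h2), h0, inner_zero_right] at h
    rw [h]
    refine integral_congr_ae (Filter.Eventually.of_forall fun x => ?_)
    simp [Complex.real_smul]
  exact (Lp.eq_zero_iff_ae_eq_zero).mpr hz

/-- The Landau Hamiltonian `H = (-i∇ - a)²`, as the self-adjoint operator in `L²(ℝ²)` with
domain `{u | (-i∇ - a)² u ∈ L²(ℝ²)}`, where `(-i∇ - a)² u` is a distribution. -/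
def landauHamiltonian (B : ℝ) : L2 →ₗ.[ℂ] L2 :=
  (landauGraph B).toLinearPMap

theorem landauHamiltonian_graph (B : ℝ) : (landauHamiltonian B).graph = landauGraph B :=
  Submodule.toLinearPMap_graph_eq _ (landauGraph_single_valued B)

/-! ### Localized Fermi projection and local Rényi entropies -/

instance : ContinuousFunctionalCalculus ℝ (L2 →L[ℂ] L2) IsSelfAdjoint :=
  IsSelfAdjoint.instContinuousFunctionalCalculus

/-- Multiplication by the indicator function of the Borel set `Λ`, an operator on `L²(ℝ²)`. -/
def indicatorOp (Λ : Set Plane) (hΛ : MeasurableSet Λ) : L2 →L[ℂ] L2 :=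
  LinearMap.mkContinuous
    { toFun := fun u => ((Lp.memLp u).indicator hΛ).toLp (Λ.indicator u)
      map_add' := fun u v => by
        rw [← MemLp.toLp_add]
        refine (MemLp.toLp_eq_toLp_iff _ _).mpr ?_
        filter_upwards [Lp.coeFn_add u v] with x hx
        by_cases h : x ∈ Λ
        · simpa [h] using hx
        · simp [h]
      map_smul' := fun c u => by
        rw [RingHom.id_apply, ← MemLp.toLp_const_smul]
        refine (MemLp.toLp_eq_toLp_iff _ _).mpr ?_
        filter_upwards [Lp.coeFn_smul c u] with x hx
        by_cases h : x ∈ Λ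
        · simpa [h] using hx
        · simp [h] }
    1 (fun u => by
      rw [one_mul]
      refine Lp.norm_le_norm_of_ae_le ?_
      filter_upwards [((Lp.memLp u).indicator hΛ).coeFn_toLp] with x hx
      simp only [LinearMap.coe_mk, AddHom.coe_mk]
      rw [hx]
      exact norm_indicator_le_norm_self _ _)

theorem indicatorOp_apply (Λ : Set Plane) (hΛ : MeasurableSet Λ) (u : L2) :
    indicatorOp Λ hΛ u =ᵐ[volume] Λ.indicator u :=
  ((Lp.memLp u).indicator hΛ).coeFn_toLp

/-- The Fermi projection `Θ(μ 𝟙 - H)` of the Landau Hamiltonian. -/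
def fermiProjection (B μ : ℝ) : L2 →L[ℂ] L2 :=
  spectralProjection (landauHamiltonian B) μ

/-- The localized Fermi projection `𝟙_Λ Θ(μ 𝟙 - H) 𝟙_Λ`. -/
def localFermiProjection (B μ : ℝ) (Λ : Set Plane) (hΛ : MeasurableSet Λ) : L2 →L[ℂ] L2 :=
  indicatorOp Λ hΛ ∘L fermiProjection B μ ∘L indicatorOp Λ hΛ

/-- The `α`-Rényi entropy function `h_α`, of interest on `[0, 1]`. With `Real.log 0 = 0`, the
function `h_1` vanishes at `0` and `1`. -/
def renyiFun (α t : ℝ) : ℝ :=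
  if α = 1 then -t * Real.log t - (1 - t) * Real.log (1 - t)
  else 1 / (1 - α) * Real.log (t ^ α + (1 - t) ^ α)

/-- The local `α`-Rényi ground-state entropy
`S_α(Λ) = tr h_α(𝟙_Λ Θ(μ 𝟙 - H) 𝟙_Λ)`, with values in `[0, ∞]`. The operator `h_α(·)` is given by
the continuous functional calculus of a self-adjoint operator with spectrum in `[0, 1]`. -/
def localRenyiEntropy (B μ α : ℝ) (Λ : Set Plane) (hΛ : MeasurableSet Λ) : ℝ≥0∞ :=
  posTrace (cfc (renyiFun α) (localFermiProjection B μ Λ hΛ))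

/-! The facts which make the definition of the entropy meaningful. -/

lemma isSelfAdjoint_indicatorOp (Λ : Set Plane) (hΛ : MeasurableSet Λ) :
    IsSelfAdjoint (indicatorOp Λ hΛ) := by
  rw [ContinuousLinearMap.isSelfAdjoint_iff_isSymmetric]
  intro u v
  change ⟪indicatorOp Λ hΛ u, v⟫_ℂ = ⟪u, indicatorOp Λ hΛ v⟫_ℂ
  rw [L2.inner_def, L2.inner_def]
  refine integral_congr_ae ?_
  filter_upwards [indicatorOp_apply Λ hΛ u, indicatorOp_apply Λ hΛ v] with x hu hv
  rw [hu, hv]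
  by_cases h : x ∈ Λ <;> simp [h]

lemma norm_indicatorOp_le (Λ : Set Plane) (hΛ : MeasurableSet Λ) (u : L2) :
    ‖indicatorOp Λ hΛ u‖ ≤ ‖u‖ := by
  refine Lp.norm_le_norm_of_ae_le ?_
  filter_upwards [indicatorOp_apply Λ hΛ u] with x hx
  rw [hx]
  exact norm_indicator_le_norm_self _ _

lemma localFermiProjection_inner (B μ : ℝ) (Λ : Set Plane) (hΛ : MeasurableSet Λ) (u : L2) :
    ⟪localFermiProjection B μ Λ hΛ u, u⟫_ℂ
      = ((‖fermiProjection B μ (indicatorOp Λ hΛ u)‖ ^ 2 : ℝ) : ℂ) := by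
  have hs : ∀ x y, ⟪indicatorOp Λ hΛ x, y⟫_ℂ = ⟪x, indicatorOp Λ hΛ y⟫_ℂ :=
    ContinuousLinearMap.isSelfAdjoint_iff_isSymmetric.mp (isSelfAdjoint_indicatorOp Λ hΛ)
  change ⟪indicatorOp Λ hΛ (fermiProjection B μ (indicatorOp Λ hΛ u)), u⟫_ℂ = _
  rw [hs]
  set w := indicatorOp Λ hΛ u
  have h2 : ⟪fermiProjection B μ w, w⟫_ℂ
      = ⟪fermiProjection B μ w, fermiProjection B μ w⟫_ℂ := by
    unfold fermiProjection spectralProjection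
    rw [Submodule.inner_starProjection_left_eq_right, Submodule.inner_starProjection_left_eq_right,
      Submodule.starProjection_eq_self_iff.mpr (Submodule.starProjection_apply_mem _ _)]
  rw [h2, inner_self_eq_norm_sq_to_K]
  norm_cast

theorem localFermiProjection_nonneg (B μ : ℝ) (Λ : Set Plane) (hΛ : MeasurableSet Λ) :
    0 ≤ localFermiProjection B μ Λ hΛ := by
  rw [ContinuousLinearMap.nonneg_iff_isPositive, ContinuousLinearMap.isPositive_iff_complex]
  intro u
  rw [localFermiProjection_inner]
  exact ⟨rfl, sq_nonneg ‖fermiProjection B μ (indicatorOp Λ hΛ u)‖⟩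

theorem localFermiProjection_le_one (B μ : ℝ) (Λ : Set Plane) (hΛ : MeasurableSet Λ) :
    localFermiProjection B μ Λ hΛ ≤ 1 := by
  rw [← sub_nonneg, ContinuousLinearMap.nonneg_iff_isPositive,
    ContinuousLinearMap.isPositive_iff_complex]
  intro u
  have e : ⟪(1 - localFermiProjection B μ Λ hΛ) u, u⟫_ℂ
      = ((‖u‖ ^ 2 - ‖fermiProjection B μ (indicatorOp Λ hΛ u)‖ ^ 2 : ℝ) : ℂ) := by
    rw [sub_apply, inner_sub_left, localFermiProjection_inner,
      one_apply_eq_self, inner_self_eq_norm_sq_to_K]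
    push_cast
    rfl
  rw [e]
  refine ⟨rfl, ?_⟩
  have h1 : ‖fermiProjection B μ (indicatorOp Λ hΛ u)‖ ≤ ‖u‖ :=
    (Submodule.norm_starProjection_apply_le _ _).trans (norm_indicatorOp_le Λ hΛ u)
  change 0 ≤ ‖u‖ ^ 2 - ‖fermiProjection B μ (indicatorOp Λ hΛ u)‖ ^ 2
  rw [sub_nonneg]
  gcongr

theorem spectrum_localFermiProjection (B μ : ℝ) (Λ : Set Plane) (hΛ : MeasurableSet Λ) :
    spectrum ℝ (localFermiProjection B μ Λ hΛ) ⊆ Set.Icc 0 1 := by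
  intro t ht
  refine ⟨spectrum_nonneg_of_nonneg (localFermiProjection_nonneg B μ Λ hΛ) ht, ?_⟩
  exact (le_algebraMap_iff_spectrum_le (A := L2 →L[ℂ] L2) (r := (1 : ℝ))
    (ha := (localFermiProjection_nonneg B μ Λ hΛ).isSelfAdjoint)).mp
    (by simpa using localFermiProjection_le_one B μ Λ hΛ) t ht

theorem continuousOn_renyiFun {α : ℝ} (hα : 0 < α) :
    ContinuousOn (renyiFun α) (Set.Icc 0 1) := by
  unfold renyiFun
  by_cases h : α = 1
  · simp only [h, if_true]
    have h1 : Continuous fun t : ℝ => t * Real.log t := Real.continuous_mul_log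
    have h2 : Continuous fun t : ℝ => (1 - t) * Real.log (1 - t) :=
      h1.comp (continuous_const.sub continuous_id)
    have h3 : Continuous fun t : ℝ => -t * Real.log t := by
      simp only [neg_mul]
      exact h1.neg
    exact (h3.sub h2).continuousOn
  · simp only [h, if_false]
    refine continuousOn_const.mul (ContinuousOn.log ?_ ?_)
    · exact ((Real.continuous_rpow_const hα.le).add
        ((Real.continuous_rpow_const hα.le).comp
          (continuous_const.sub continuous_id))).continuousOn
    · rintro t ⟨h0, h1⟩
      rcases h0.eq_or_lt with rfl | h0
      · simp [Real.zero_rpow hα.ne']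
      · have := Real.rpow_pos_of_pos h0 α
        have := Real.rpow_nonneg (sub_nonneg.mpr h1) α
        positivity

theorem renyiFun_nonneg {α t : ℝ} (hα : 0 < α) (ht : t ∈ Set.Icc (0 : ℝ) 1) :
    0 ≤ renyiFun α t := by
  obtain ⟨h0, h1⟩ := ht
  unfold renyiFun
  split_ifs with h
  · have e1 := Real.mul_log_nonpos h0 h1
    have e2 := Real.mul_log_nonpos (sub_nonneg.mpr h1) (by linarith)
    linarith
  · rcases lt_or_gt_of_ne h with hlt | hgt
    · have a1 : t ≤ t ^ α := by
        simpa using Real.rpow_le_rpow_of_exponent_ge' h0 h1 hα.le hlt.le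
      have a2 : 1 - t ≤ (1 - t) ^ α := by
        simpa using Real.rpow_le_rpow_of_exponent_ge' (sub_nonneg.mpr h1) (by linarith) hα.le hlt.le
      exact mul_nonneg (by rw [one_div]; exact inv_nonneg.mpr (by linarith))
        (Real.log_nonneg (by linarith))
    · have a1 : t ^ α ≤ t := by
        simpa using Real.rpow_le_rpow_of_exponent_ge' h0 h1 zero_le_one hgt.le
      have a2 : (1 - t) ^ α ≤ 1 - t := by
        simpa using Real.rpow_le_rpow_of_exponent_ge' (sub_nonneg.mpr h1) (by linarith)
          zero_le_one hgt.le
      have a3 := Real.rpow_nonneg h0 α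
      have a4 := Real.rpow_nonneg (sub_nonneg.mpr h1) α
      exact mul_nonneg_of_nonpos_of_nonpos
        (by rw [one_div]; exact inv_nonpos.mpr (by linarith))
        (Real.log_nonpos (by linarith) (by linarith))

/-- The operator whose trace is the entropy is positive. -/
theorem cfc_renyiFun_nonneg (B μ : ℝ) {α : ℝ} (hα : 0 < α) (Λ : Set Plane)
    (hΛ : MeasurableSet Λ) : 0 ≤ cfc (renyiFun α) (localFermiProjection B μ Λ hΛ) :=
  cfc_nonneg fun _ ht => renyiFun_nonneg hα (spectrum_localFermiProjection B μ Λ hΛ ht)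

end LandauEntropy

end

noncomputable section

namespace LandauEntropy

/-! ### A power bound for the entropy function -/

/-! On `[0, 1]` every `h_α` is at most `C t ^ γ` for some `γ < 1`, so it is enough that the
localized Fermi projection `T` decays fast enough for `T ^ γ` to have finite trace. Only finitely
many Landau levels `B (2n + 1)` are at most `μ`. Within these, the squared norm of the eigenfunction
with second index `m` is of order `m! / β ^ m`, with `β = B / 2`, while its size on a bounded set
grows at most exponentially in `m`. After normalisation the mass on `Λ` is therefore `O(Y ^ m /
m!)`, and the form of `T` is dominated by `∑ |⟨x, φ j⟩|²` with `φ j` the localized eigenfunctions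
and `‖φ j‖²` geometrically small.

`posTrace_cfc_lt_top` turns this into a finite trace without singular values. Gram-Schmidt gives `e
k` orthogonal to `φ j` for `j < k`, so `⟨e k, T e k⟩` is at most a geometric tail `s k`. An affine
majorant of `t ^ γ` then bounds `⟨e k, h(T) e k⟩` by `2 C (s k) ^ γ`, which is summable.

The domination is `re_inner_localFermiProjection_le`. Eigenvectors with eigenvalue above `μ` are
orthogonal to the Fermi range (`inner_eq_zero_of_mem_spectralSubspace`), and since the
eigenfunctions are complete (`eq_zero_of_inner_landauVec_eq_zero`), that range is spanned by low
levels. -/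

theorem renyiFun_le_rpow {α : ℝ} (hα : 0 < α) :
    ∃ C γ : ℝ, 0 ≤ C ∧ 0 < γ ∧ γ < 1 ∧ ∀ t ∈ Set.Icc (0 : ℝ) 1, renyiFun α t ≤ C * t ^ γ := by
  have hsqrt : ∀ t ∈ Set.Icc (0 : ℝ) 1, t ≤ t ^ (1 / 2 : ℝ) := fun t ht => by
    simpa using Real.rpow_le_rpow_of_exponent_ge' ht.1 ht.2 (by norm_num : (0 : ℝ) ≤ 1 / 2)
      (by norm_num : (1 / 2 : ℝ) ≤ 1)
  have hlog : ∀ y : ℝ, 0 < y → -Real.log y ≤ 1 / y - 1 := fun y hy => by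
    have := Real.log_le_sub_one_of_pos (one_div_pos.mpr hy)
    rwa [one_div, Real.log_inv, ← one_div] at this
  rcases lt_trichotomy α 1 with h | h | h
  -- For `α < 1`, `log y ≤ y - 1` and `(1 - t) ^ α ≤ 1` leave exactly `t ^ α`.
  · refine ⟨1 / (1 - α), α, by rw [one_div]; exact inv_nonneg.mpr (by linarith), hα, h, ?_⟩
    rintro t ⟨h0, h1⟩
    rw [renyiFun, if_neg h.ne]
    refine mul_le_mul_of_nonneg_left ?_ (by rw [one_div]; exact inv_nonneg.mpr (by linarith))
    have hpos : 0 < t ^ α + (1 - t) ^ α := by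
      rcases h0.eq_or_lt with rfl | h0
      · simp [Real.zero_rpow hα.ne']
      · have := Real.rpow_pos_of_pos h0 α
        have := Real.rpow_nonneg (sub_nonneg.mpr h1) α
        positivity
    have h2 : (1 - t) ^ α ≤ 1 := Real.rpow_le_one (by linarith) (by linarith) hα.le
    linarith [Real.log_le_sub_one_of_pos hpos]
  · subst h
    -- `-t log t` costs `2 √t`, from `log y ≤ y ^ ε / ε` at `y = 1 / t`, `ε = 1 / 2`; the other
    -- summand costs `t ≤ √t`.
    refine ⟨3, 1 / 2, by norm_num, by norm_num, by norm_num, ?_⟩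
    rintro t ⟨h0, h1⟩
    rw [renyiFun, if_pos rfl]
    have e1 : -t * Real.log t ≤ 2 * t ^ (1 / 2 : ℝ) := by
      rcases h0.eq_or_lt with rfl | h0
      · simp
      · have h2 := Real.log_le_rpow_div (inv_nonneg.mpr h0.le) (by norm_num : (0 : ℝ) < 1 / 2)
        rw [Real.log_inv, Real.inv_rpow h0.le] at h2
        have h3 : t * (t ^ (1 / 2 : ℝ))⁻¹ = t ^ (1 / 2 : ℝ) := by
          rw [← Real.rpow_neg h0.le]
          nth_rewrite 1 [← Real.rpow_one t]
          rw [← Real.rpow_add h0]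
          norm_num
        calc -t * Real.log t = t * -Real.log t := by ring
          _ ≤ t * ((t ^ (1 / 2 : ℝ))⁻¹ / (1 / 2)) := mul_le_mul_of_nonneg_left h2 h0.le
          _ = 2 * (t * (t ^ (1 / 2 : ℝ))⁻¹) := by ring
          _ = _ := by rw [h3]
    have e2 : -((1 - t) * Real.log (1 - t)) ≤ t := by
      rcases h1.eq_or_lt with rfl | h1
      · simp
      · have h2 := mul_le_mul_of_nonneg_left (hlog (1 - t) (by linarith))
          (by linarith : (0 : ℝ) ≤ 1 - t)
        have h3 : (1 - t) * (1 / (1 - t) - 1) = t := by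
          have : 1 - t ≠ 0 := by linarith
          field_simp
          ring
        linarith
    linarith [hsqrt t ⟨h0, h1⟩]
  -- For `α > 1` the bound is even linear in `t`; it is weakened by `t ≤ √t` to have an exponent
  -- below `1`.
  · refine ⟨1 / (α - 1) * (2 * α), 1 / 2, ?_, by norm_num, by norm_num, ?_⟩
    · have : 0 < α - 1 := by linarith
      positivity
    rintro t ⟨h0, h1⟩
    rw [renyiFun, if_neg h.ne']
    have e : 1 / (1 - α) * Real.log (t ^ α + (1 - t) ^ α)
        = 1 / (α - 1) * -Real.log (t ^ α + (1 - t) ^ α) := by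
      rw [← neg_sub α 1, one_div_neg_eq_neg_one_div]
      ring
    rw [e, mul_assoc]
    refine mul_le_mul_of_nonneg_left ?_ (by rw [one_div]; exact inv_nonneg.mpr (by linarith))
    suffices -Real.log (t ^ α + (1 - t) ^ α) ≤ 2 * α * t from
      this.trans (mul_le_mul_of_nonneg_left (hsqrt t ⟨h0, h1⟩) (by positivity))
    -- Only the larger of the two powers is kept inside the logarithm.
    rcases le_total t (1 / 2) with ht | ht
    · have p : 0 < (1 - t) ^ α := Real.rpow_pos_of_pos (by linarith) α
      have q : (1 - t) ^ α ≤ t ^ α + (1 - t) ^ α := by linarith [Real.rpow_nonneg h0 α]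
      have r := Real.log_le_log p q
      rw [Real.log_rpow (by linarith)] at r
      have s : 1 / (1 - t) - 1 ≤ 2 * t := by
        have : 1 / (1 - t) - 1 = t / (1 - t) := by
          have : 1 - t ≠ 0 := by linarith
          field_simp
          ring
        rw [this, div_le_iff₀ (by linarith)]
        nlinarith
      have := mul_le_mul_of_nonneg_left ((hlog (1 - t) (by linarith)).trans s) hα.le
      linarith
    · have p : 0 < t ^ α := Real.rpow_pos_of_pos (by linarith) α
      have q : t ^ α ≤ t ^ α + (1 - t) ^ α := by
        linarith [Real.rpow_nonneg (by linarith : 0 ≤ 1 - t) α]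
      have r := Real.log_le_log p q
      rw [Real.log_rpow (by linarith)] at r
      have s : 1 / t - 1 ≤ 2 * t := by
        have : 1 / t ≤ 2 := by
          rw [div_le_iff₀ (by linarith)]
          linarith
        linarith
      have := mul_le_mul_of_nonneg_left ((hlog t (by linarith)).trans s) hα.le
      linarith

/-- For `t ≤ s` the constant term suffices, for `t ≥ s` the linear one, because `t ^ (γ - 1)`
decreases. This affine majorant replaces the tangent line in Jensen's inequality, at the price of a
factor `2` at `t = s`. -/
theorem rpow_le_linear {t s γ : ℝ} (ht : 0 ≤ t) (hs : 0 < s) (h0 : 0 < γ) (h1 : γ < 1) :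
    t ^ γ ≤ s ^ (γ - 1) * t + s ^ γ := by
  rcases le_total t s with h | h
  · have := Real.rpow_le_rpow ht h h0.le
    have := Real.rpow_nonneg hs.le (γ - 1)
    nlinarith
  · have ht' : 0 < t := hs.trans_le h
    have e : t ^ γ = t ^ (γ - 1) * t := by
      rw [Real.rpow_sub_one ht'.ne', div_mul_cancel₀ _ ht'.ne']
    rw [e]
    have := mul_le_mul_of_nonneg_right
      (Real.rpow_le_rpow_of_nonpos hs h (by linarith : γ - 1 ≤ 0)) ht'.le
    have := Real.rpow_nonneg hs.le γ
    linarith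

/-! ### Traces of functions of an operator -/

section Abstract

variable {H : Type*} [NormedAddCommGroup H] [InnerProductSpace ℂ H]

theorem re_inner_mono {S T : H →L[ℂ] H} (h : S ≤ T) (x : H) :
    (⟪x, S x⟫_ℂ).re ≤ (⟪x, T x⟫_ℂ).re := by
  rw [ContinuousLinearMap.le_def] at h
  have := h.re_inner_nonneg_right x
  rw [sub_apply, inner_sub_right, map_sub] at this
  exact sub_nonneg.mp this

theorem inner_gramSchmidtNormed_eq_zero (f : ℕ → H) {j k : ℕ} (h : j < k) :
    ⟪InnerProductSpace.gramSchmidtNormed ℂ f k, f j⟫_ℂ = 0 := by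
  rw [InnerProductSpace.gramSchmidtNormed, inner_smul_left,
    InnerProductSpace.gramSchmidt_inv_triangular ℂ f h, mul_zero]

variable [CompleteSpace H]

/-- A quantitative form of Jensen's inequality for the diagonal entries of `h(T)`. -/
theorem re_inner_cfc_le [ContinuousFunctionalCalculus ℝ (H →L[ℂ] H) IsSelfAdjoint]
    {T : H →L[ℂ] H} (hT : 0 ≤ T) {h : ℝ → ℝ} {C γ : ℝ}
    (hC : 0 ≤ C) (hγ0 : 0 < γ) (hγ1 : γ < 1) (hc : ContinuousOn h (spectrum ℝ T))
    (hh : ∀ t ∈ spectrum ℝ T, h t ≤ C * t ^ γ) {x : H} (hx : ‖x‖ = 1) {s : ℝ} (hs : 0 < s)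
    (hxs : (⟪x, T x⟫_ℂ).re ≤ s) :
    (⟪x, cfc h T x⟫_ℂ).re ≤ 2 * C * s ^ γ := by
  have hsa : IsSelfAdjoint T := hT.isSelfAdjoint
  -- The majorant passes to operators by monotonicity of the functional calculus; being affine in
  -- `T`, its diagonal entry at `x` depends on `⟨x, T x⟩` alone.
  have h1 : cfc h T ≤ cfc (fun t => C * s ^ (γ - 1) * t + C * s ^ γ) T := by
    refine cfc_mono (fun t ht => ?_) hc (by fun_prop)
    have h0 : 0 ≤ t := spectrum_nonneg_of_nonneg hT ht
    have := mul_le_mul_of_nonneg_left (rpow_le_linear h0 hs hγ0 hγ1) hC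
    linarith [hh t ht]
  have h2 : cfc (fun t => C * s ^ (γ - 1) * t + C * s ^ γ) T
      = (C * s ^ (γ - 1)) • T + algebraMap ℝ (H →L[ℂ] H) (C * s ^ γ) := by
    rw [cfc_add T (fun t => C * s ^ (γ - 1) * t) (fun _ => C * s ^ γ), cfc_const_mul_id _ T,
      cfc_const _ T]
  have h3 := re_inner_mono h1 x
  have e : ((C * s ^ (γ - 1)) • T + algebraMap ℝ (H →L[ℂ] H) (C * s ^ γ)) x
      = ((C * s ^ (γ - 1) : ℝ) : ℂ) • T x + ((C * s ^ γ : ℝ) : ℂ) • x := by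
    rw [Algebra.algebraMap_eq_smul_one, Complex.coe_smul, Complex.coe_smul]
    rfl
  rw [h2, e, inner_add_right, inner_smul_right, inner_smul_right, inner_self_eq_norm_sq_to_K, hx,
    Complex.add_re, Complex.re_ofReal_mul, Complex.re_ofReal_mul] at h3
  have h4 : s ^ (γ - 1) * s = s ^ γ := by
    rw [Real.rpow_sub_one hs.ne', div_mul_cancel₀ _ hs.ne']
  have h5 := mul_le_mul_of_nonneg_left hxs
    (mul_nonneg hC (Real.rpow_nonneg hs.le (γ - 1)))
  have h6 : C * s ^ (γ - 1) * s = C * s ^ γ := by rw [mul_assoc, h4]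
  norm_num at h3
  linarith

/-- If the form of `T` is dominated by a sum of rank-one forms with geometrically decaying
norms, and `h(t) ≤ C t ^ γ`, then `h(T)` has finite trace. -/
theorem posTrace_cfc_lt_top [ContinuousFunctionalCalculus ℝ (H →L[ℂ] H) IsSelfAdjoint]
    {T : H →L[ℂ] H} (hT : 0 ≤ T) {h : ℝ → ℝ} {C γ : ℝ}
    (hC : 0 ≤ C) (hγ0 : 0 < γ) (hγ1 : γ < 1) (hc : ContinuousOn h (spectrum ℝ T))
    (hh0 : ∀ t ∈ spectrum ℝ T, 0 ≤ h t) (hh : ∀ t ∈ spectrum ℝ T, h t ≤ C * t ^ γ)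
    (φ : ℕ → H) {K r : ℝ} (hK : 0 < K) (hr0 : 0 < r) (hr1 : r < 1)
    (hφ : ∀ j, ‖φ j‖ ^ 2 ≤ K * r ^ j)
    (hTφ : ∀ x, (⟪x, T x⟫_ℂ).re ≤ ∑' j, ‖⟪x, φ j⟫_ℂ‖ ^ 2) :
    posTrace (cfc h T) < ⊤ := by
  classical
  -- `e k` vanishes when `φ k` depends linearly on its predecessors; the nonzero ones are completed
  -- to a Hilbert basis.
  set e := InnerProductSpace.gramSchmidtNormed ℂ φ with he
  have horth : Orthonormal ℂ (fun i : {i | e i ≠ 0} => e i) :=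
    InnerProductSpace.gramSchmidtNormed_orthonormal' φ
  obtain ⟨w, b, hw, hb⟩ := horth.toSubtypeRange.exists_hilbertBasis_extension
  rw [posTrace_eq b (cfc_nonneg hh0)]
  -- The tail `∑_{j ≥ k} K r ^ j`, all that remains in the `k`-th diagonal entry.
  set s : ℕ → ℝ := fun k => K * (1 - r)⁻¹ * r ^ k with hs
  have hspos : ∀ k, 0 < s k := fun k => by
    have : 0 < 1 - r := by linarith
    positivity
  have hunit : ∀ v : w, ‖(v : H)‖ = 1 := fun v => by
    rw [← congrFun hb v]
    exact b.orthonormal.1 v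
  -- the vectors of the basis which are not among the `e k` are orthogonal to all `φ j`
  have hother : ∀ v : w, (∀ k, (v : H) ≠ e k) → ∀ j, ⟪(v : H), φ j⟫_ℂ = 0 := by
    intro v hv j
    have hsp : φ j ∈ Submodule.span ℂ (Set.range e) := by
      rw [he, InnerProductSpace.span_gramSchmidtNormed_range, InnerProductSpace.span_gramSchmidt]
      exact Submodule.subset_span ⟨j, rfl⟩
    have : Submodule.span ℂ (Set.range e) ≤ (Submodule.span ℂ {(v : H)})ᗮ := by
      rw [Submodule.span_le]
      rintro _ ⟨k, rfl⟩
      rw [SetLike.mem_coe, Submodule.mem_orthogonal_singleton_iff_inner_right]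
      by_cases hk : e k = 0
      · rw [hk, inner_zero_right]
      · have hkw : e k ∈ w := hw ⟨⟨k, hk⟩, rfl⟩
        have := b.orthonormal.2 (i := v) (j := ⟨e k, hkw⟩) (fun h => hv k (by rw [h]))
        rwa [hb] at this
    exact Submodule.mem_orthogonal_singleton_iff_inner_right.mp (this hsp)
  have hdiag_e : ∀ (v : w) (k : ℕ), (v : H) = e k → (⟪(v : H), T v⟫_ℂ).re ≤ s k := by
    intro v k hv
    refine (hTφ v).trans ?_
    have hb1 : ∀ j, ‖⟪(v : H), φ j⟫_ℂ‖ ^ 2 ≤ K * r ^ j := fun j => by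
      have := norm_inner_le_norm (𝕜 := ℂ) (v : H) (φ j)
      rw [hunit v, one_mul] at this
      exact (pow_le_pow_left₀ (norm_nonneg _) this 2).trans (hφ j)
    have hsumm : Summable fun j => ‖⟪(v : H), φ j⟫_ℂ‖ ^ 2 :=
      Summable.of_nonneg_of_le (fun _ => by positivity) hb1
        ((summable_geometric_of_lt_one hr0.le hr1).mul_left K)
    rw [← hsumm.sum_add_tsum_nat_add k, Finset.sum_eq_zero, zero_add]
    · have hg : HasSum (fun i => K * r ^ (i + k)) (s k) := by
        have := ((hasSum_geometric_of_lt_one hr0.le hr1).mul_left (K * r ^ k))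
        have e1 : (fun i => K * r ^ (i + k)) = fun i => K * r ^ k * r ^ i := by
          funext i
          ring
        have e2 : s k = K * r ^ k * (1 - r)⁻¹ := by
          simp only [hs]
          ring
        rwa [e1, e2]
      rw [← hg.tsum_eq]
      exact ((summable_nat_add_iff k).mpr hsumm).tsum_le_tsum (fun i => hb1 (i + k)) hg.summable
    · intro j hj
      rw [hv, inner_gramSchmidtNormed_eq_zero φ (Finset.mem_range.mp hj)]
      simp
  -- Summing over all `k` with an indicator avoids reindexing the basis; the two sums are
  -- interchanged below.
  have hbound : ∀ v : w, ENNReal.ofReal (⟪b v, cfc h T (b v)⟫_ℂ).re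
      ≤ ∑' k, if (v : H) = e k then ENNReal.ofReal (2 * C * s k ^ γ) else 0 := by
    intro v
    rw [hb]
    by_cases hv : ∃ k, (v : H) = e k
    · obtain ⟨k, hk⟩ := hv
      refine le_trans ?_ (ENNReal.le_tsum k)
      rw [if_pos hk]
      exact ENNReal.ofReal_le_ofReal
        (re_inner_cfc_le hT hC hγ0 hγ1 hc hh (hunit v) (hspos k) (hdiag_e v k hk))
    · push Not at hv
      have h0 : (⟪(v : H), T v⟫_ℂ).re ≤ 0 := by
        refine (hTφ v).trans ?_
        simp [hother v hv]
      -- The diagonal bound requires `s > 0`, so `s` is sent to `0`.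
      have h1 : (⟪(v : H), cfc h T v⟫_ℂ).re ≤ 0 := by
        have ht : Filter.Tendsto (fun s : ℝ => 2 * C * s ^ γ) (nhdsWithin 0 (Set.Ioi 0))
            (nhds (2 * C * 0 ^ γ)) :=
          (((Real.continuous_rpow_const hγ0.le).const_mul (2 * C)).tendsto 0).mono_left
            nhdsWithin_le_nhds
        rw [Real.zero_rpow hγ0.ne', mul_zero] at ht
        refine ge_of_tendsto ht ?_
        filter_upwards [self_mem_nhdsWithin] with s hs
        exact re_inner_cfc_le hT hC hγ0 hγ1 hc hh (hunit v) hs (h0.trans (le_of_lt hs))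
      rw [ENNReal.ofReal_of_nonpos h1]
      exact zero_le
  have hone : ∀ k, ∑' v : w, (if (v : H) = e k then ENNReal.ofReal (2 * C * s k ^ γ) else 0)
      ≤ ENNReal.ofReal (2 * C * s k ^ γ) := by
    intro k
    by_cases hk : e k ∈ w
    · rw [tsum_eq_single ⟨e k, hk⟩ (fun v hv => if_neg fun h => hv (Subtype.ext h))]
      simp
    · have hne : ∀ v : w, (v : H) ≠ e k := fun v hv => hk (hv ▸ v.2)
      simp only [hne, if_false, tsum_zero]
      exact zero_le
  calc ∑' v, ENNReal.ofReal (⟪b v, cfc h T (b v)⟫_ℂ).re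
      ≤ ∑' v : w, ∑' k, if (v : H) = e k then ENNReal.ofReal (2 * C * s k ^ γ) else 0 :=
        ENNReal.tsum_le_tsum hbound
    _ = ∑' k, ∑' v : w, if (v : H) = e k then ENNReal.ofReal (2 * C * s k ^ γ) else 0 :=
        ENNReal.tsum_comm
    _ ≤ ∑' k, ENNReal.ofReal (2 * C * s k ^ γ) := ENNReal.tsum_le_tsum hone
    _ < ⊤ := by
      have hsum : Summable fun k => 2 * C * s k ^ γ := by
        -- The `γ`-th power of a geometric sequence is geometric, with ratio `r ^ γ < 1`.
        have h1 : ∀ k, 2 * C * s k ^ γ = 2 * C * (K * (1 - r)⁻¹) ^ γ * (r ^ γ) ^ k := fun k => by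
          have : 0 < 1 - r := by linarith
          rw [hs, Real.mul_rpow (by positivity) (by positivity), ← Real.rpow_natCast,
            ← Real.rpow_natCast, ← Real.rpow_mul hr0.le, ← Real.rpow_mul hr0.le, mul_comm γ]
          ring
        simp_rw [h1]
        exact (summable_geometric_of_lt_one (Real.rpow_nonneg hr0.le γ)
          (Real.rpow_lt_one hr0.le hr1 hγ0)).mul_left _
      exact hsum.tsum_ofReal_lt_top

end Abstract

/-! ### Landau eigenfunctions -/

/-- The complex coordinate `x₁ + i x₂` as a real-linear map. -/
def zL : Plane →L[ℝ] ℂ :=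
  Complex.ofRealCLM ∘L EuclideanSpace.proj 0 + Complex.I • Complex.ofRealCLM ∘L EuclideanSpace.proj 1

/-- The conjugate complex coordinate `x₁ - i x₂` as a real-linear map. -/
def zbL : Plane →L[ℝ] ℂ :=
  Complex.ofRealCLM ∘L EuclideanSpace.proj 0 - Complex.I • Complex.ofRealCLM ∘L EuclideanSpace.proj 1

theorem zL_apply (x : Plane) : zL x = x 0 + Complex.I * x 1 := rfl

theorem zbL_apply (x : Plane) : zbL x = x 0 - Complex.I * x 1 := rfl

theorem conj_zL (x : Plane) : starRingEnd ℂ (zL x) = zbL x := by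
  simp [zL_apply, zbL_apply, sub_eq_add_neg]

theorem conj_zbL (x : Plane) : starRingEnd ℂ (zbL x) = zL x := by
  rw [← conj_zL, Complex.conj_conj]

theorem zL_mul_zbL (x : Plane) : zL x * zbL x = ((‖x‖ ^ 2 : ℝ) : ℂ) := by
  rw [EuclideanSpace.norm_sq_eq, Fin.sum_univ_two, zL_apply, zbL_apply]
  simp only [Real.norm_eq_abs, sq_abs]
  push_cast
  linear_combination -(x 1 : ℂ) ^ 2 * Complex.I_sq

theorem norm_zL (x : Plane) : ‖zL x‖ = ‖x‖ := by
  have h : ‖zL x‖ ^ 2 = ‖x‖ ^ 2 := by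
    have := zL_mul_zbL x
    rw [← conj_zL, Complex.mul_conj, Complex.normSq_eq_norm_sq] at this
    exact_mod_cast this
  exact (pow_left_inj₀ (norm_nonneg _) (norm_nonneg _) two_ne_zero).mp h

theorem norm_zbL (x : Plane) : ‖zbL x‖ = ‖x‖ := by
  rw [← conj_zL, RCLike.norm_conj, norm_zL]

/-- The polynomial factors of the Landau eigenfunctions, `(β z - ∂_z̄) ^ n z̄ ^ m`. -/
def landauPoly (β : ℝ) : ℕ → ℕ → Plane → ℂ
  | 0, m, x => zbL x ^ m
  | n + 1, m, x => β * zL x * landauPoly β n m x - m * landauPoly β n (m - 1) x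

theorem landauPoly_zero (β : ℝ) (m : ℕ) (x : Plane) : landauPoly β 0 m x = zbL x ^ m := by
  rw [landauPoly]

theorem landauPoly_succ (β : ℝ) (n m : ℕ) (x : Plane) :
    landauPoly β (n + 1) m x = β * zL x * landauPoly β n m x - m * landauPoly β n (m - 1) x := by
  rw [landauPoly]

/-- With `D = β z - ∂_z̄` one has `[z̄, D] = 1`, hence `z̄ D ^ n = D ^ n z̄ + n D ^ (n - 1)`. Here
and below a truncated index `n - 1` or `m - 1` carries the factor `n` or `m`, so its value at zero
is harmless. -/
theorem zbL_mul_landauPoly (β : ℝ) (n m : ℕ) (x : Plane) :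
    zbL x * landauPoly β n m x = landauPoly β n (m + 1) x + n * landauPoly β (n - 1) m x := by
  induction n generalizing m with
  | zero => simp [landauPoly_zero, pow_succ']
  | succ n ih =>
    have e1 : (m : ℂ) * landauPoly β n (m - 1 + 1) x = m * landauPoly β n m x := by
      cases m <;> simp
    have e2 : (n : ℂ) * landauPoly β n m x = n * (β * zL x * landauPoly β (n - 1) m x
        - m * landauPoly β (n - 1) (m - 1) x) := by
      cases n with
      | zero => simp
      | succ n => rw [← landauPoly_succ, Nat.add_sub_cancel]
    rw [landauPoly_succ, landauPoly_succ, Nat.add_sub_cancel, Nat.add_sub_cancel]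
    push_cast
    linear_combination β * zL x * ih m - m * ih (m - 1) - e1 - e2

/-- The coefficients of `zL` and `zbL` are the Wirtinger derivatives `∂_z` and `∂_z̄`. They come
from `[∂_z, D] = β` and `[∂_z̄, D] = 0`. -/
theorem hasFDerivAt_landauPoly (β : ℝ) (n m : ℕ) (x : Plane) :
    HasFDerivAt (landauPoly β n m)
      ((n * β * landauPoly β (n - 1) m x) • zL + (m * landauPoly β n (m - 1) x) • zbL) x := by
  induction n generalizing m with
  | zero =>
    have h : HasFDerivAt (fun x => zbL x ^ m) _ x := zbL.hasFDerivAt.pow m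
    have e : landauPoly β 0 m = fun x => zbL x ^ m := funext (landauPoly_zero β m)
    rw [e]
    refine h.congr_fderiv ?_
    ext v
    simp [landauPoly_zero]
  | succ n ih =>
    have e : landauPoly β (n + 1) m = fun x => β * zL x * landauPoly β n m x
        - m * landauPoly β n (m - 1) x := funext (landauPoly_succ β n m)
    have h : HasFDerivAt (fun x => β * zL x * landauPoly β n m x
        - m * landauPoly β n (m - 1) x) _ x :=
      ((zL.hasFDerivAt.const_mul (β : ℂ)).mul (ih m)).sub ((ih (m - 1)).const_mul (m : ℂ))
    rw [e]
    refine h.congr_fderiv ?_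
    ext v
    have e2 : (n : ℂ) * landauPoly β n m x = n * (β * zL x * landauPoly β (n - 1) m x
        - m * landauPoly β (n - 1) (m - 1) x) := by
      cases n with
      | zero => simp
      | succ n => rw [← landauPoly_succ, Nat.add_sub_cancel]
    have e3 : (m : ℂ) * landauPoly β (n + 1) (m - 1) x = m * (β * zL x * landauPoly β n (m - 1) x
        - (m - 1 : ℕ) * landauPoly β n (m - 1 - 1) x) := by
      rw [landauPoly_succ]
    simp only [FunLike.coe_sub, FunLike.coe_smul, Pi.sub_apply,
      add_apply, Pi.smul_apply, smul_eq_mul, Nat.add_sub_cancel, Nat.cast_add,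
      Nat.cast_one, e3]
    linear_combination -(β : ℂ) * zL v * e2

/-- The Gaussian factor of the Landau eigenfunctions. -/
def gauss (β : ℝ) (x : Plane) : ℂ := Complex.exp (-(β / 2) * (zL x * zbL x))

theorem gauss_eq (β : ℝ) (x : Plane) : gauss β x = (Real.exp (-(β / 2) * ‖x‖ ^ 2) : ℝ) := by
  rw [gauss, zL_mul_zbL]
  push_cast
  rfl

theorem hasFDerivAt_gauss (β : ℝ) (x : Plane) :
    HasFDerivAt (gauss β) ((-(β / 2) * gauss β x * zbL x) • zL
      + (-(β / 2) * gauss β x * zL x) • zbL) x := by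
  have h : HasFDerivAt (fun x => Complex.exp (-(β / 2) * (zL x * zbL x))) _ x :=
    ((zL.hasFDerivAt.mul zbL.hasFDerivAt).const_mul (-(β / 2) : ℂ)).cexp
  refine h.congr_fderiv ?_
  ext v
  simp [gauss]
  ring

/-- The (unnormalised) Landau eigenfunctions. -/
def landauFun (β : ℝ) (n m : ℕ) (x : Plane) : ℂ := landauPoly β n m x * gauss β x

theorem zL_mul_landauFun (β : ℝ) (n m : ℕ) (x : Plane) :
    β * zL x * landauFun β n m x = landauFun β (n + 1) m x + m * landauFun β n (m - 1) x := by
  simp only [landauFun, landauPoly_succ]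
  ring

theorem zbL_mul_landauFun (β : ℝ) (n m : ℕ) (x : Plane) :
    zbL x * landauFun β n m x = landauFun β n (m + 1) x + n * landauFun β (n - 1) m x := by
  simp only [landauFun]
  linear_combination gauss β x * zbL_mul_landauPoly β n m x

/-- The Gaussian contributes multiplications by `z̄` and `z`, which the two preceding relations
convert into index shifts: derivatives stay within the family. -/
theorem hasFDerivAt_landauFun (β : ℝ) (n m : ℕ) (x : Plane) :
    HasFDerivAt (landauFun β n m)
      ((β / 2 * (n * landauFun β (n - 1) m x - landauFun β n (m + 1) x)) • zL
        + (1 / 2 * (m * landauFun β n (m - 1) x - landauFun β (n + 1) m x)) • zbL) x := by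
  have h : HasFDerivAt (fun x => landauPoly β n m x * gauss β x) _ x :=
    (hasFDerivAt_landauPoly β n m x).mul (hasFDerivAt_gauss β x)
  refine h.congr_fderiv ?_
  ext v
  have e1 := zL_mul_landauFun β n m x
  have e2 := zbL_mul_landauFun β n m x
  simp only [landauFun] at e1 e2 ⊢
  simp only [FunLike.coe_smul, add_apply, Pi.smul_apply,
    smul_eq_mul]
  linear_combination -(β / 2) * zL v * e2 - (1 / 2) * zbL v * e1

theorem contDiff_landauFun (β : ℝ) (n m : ℕ) : ContDiff ℝ ∞ (landauFun β n m) := by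
  have hg : ContDiff ℝ ∞ (gauss β) := by
    unfold gauss
    exact (contDiff_const.mul (zL.contDiff.mul zbL.contDiff)).cexp
  have hp : ∀ m, ContDiff ℝ ∞ (landauPoly β n m) := by
    induction n with
    | zero =>
      intro m
      rw [funext (landauPoly_zero β m)]
      exact zbL.contDiff.pow m
    | succ n ih =>
      intro m
      rw [funext (landauPoly_succ β n m)]
      exact ((contDiff_const.mul zL.contDiff).mul (ih m)).sub (contDiff_const.mul (ih _))
  exact (hp m).mul hg

theorem zL_single_zero : zL (EuclideanSpace.single 0 1) = 1 := by simp [zL_apply]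
theorem zL_single_one : zL (EuclideanSpace.single 1 1) = Complex.I := by simp [zL_apply]
theorem zbL_single_zero : zbL (EuclideanSpace.single 0 1) = 1 := by simp [zbL_apply]
theorem zbL_single_one : zbL (EuclideanSpace.single 1 1) = -Complex.I := by simp [zbL_apply]

/-! ### Ladder relations and the eigenvalue equation. -/

theorem momentum_zero_landauFun (B : ℝ) (n m : ℕ) (x : Plane) :
    momentum B 0 (landauFun (B / 2) n m) x
      = Complex.I * (landauFun (B / 2) (n + 1) m x
        - n * (B / 2) * landauFun (B / 2) (n - 1) m x) := by
  rw [momentum, (hasFDerivAt_landauFun _ n m x).fderiv]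
  have e1 := zL_mul_landauFun (B / 2) n m x
  have e2 := zbL_mul_landauFun (B / 2) n m x
  simp only [FunLike.coe_smul, add_apply, Pi.smul_apply,
    smul_eq_mul, zL_single_zero, zbL_single_zero, vecPot, if_true]
  rw [zL_apply] at e1
  rw [zbL_apply] at e2
  push_cast at e1 e2 ⊢
  linear_combination (Complex.I / 2) * e1 - (Complex.I * B / 4) * e2
    - B / 2 * x 1 * landauFun (B / 2) n m x * Complex.I_sq

/-- For `β = B / 2` the shifts in `m` cancel. With `a†` raising `n` and `a` lowering it with factor
`n B / 2`, the two momenta are `i (a† - a)` and `a† + a`. -/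
theorem momentum_one_landauFun (B : ℝ) (n m : ℕ) (x : Plane) :
    momentum B 1 (landauFun (B / 2) n m) x
      = landauFun (B / 2) (n + 1) m x + n * (B / 2) * landauFun (B / 2) (n - 1) m x := by
  rw [momentum, (hasFDerivAt_landauFun _ n m x).fderiv]
  have e1 := zL_mul_landauFun (B / 2) n m x
  have e2 := zbL_mul_landauFun (B / 2) n m x
  simp only [FunLike.coe_smul, add_apply, Pi.smul_apply,
    smul_eq_mul, zL_single_one, zbL_single_one, vecPot, one_ne_zero, if_false]
  rw [zL_apply] at e1
  rw [zbL_apply] at e2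
  push_cast at e1 e2 ⊢
  linear_combination (1 / 2) * e1 + (B / 4) * e2
    + (1 / 2 * (m * landauFun (B / 2) n (m - 1) x - landauFun (B / 2) (n + 1) m x)
      - B / 4 * (n * landauFun (B / 2) (n - 1) m x - landauFun (B / 2) n (m + 1) x))
      * Complex.I_sq

theorem momentum_add_smul (B : ℝ) (j : Fin 2) {φ ψ : Plane → ℂ} (c d : ℂ) {x : Plane}
    (hφ : DifferentiableAt ℝ φ x) (hψ : DifferentiableAt ℝ ψ x) :
    momentum B j (fun y => c * φ y + d * ψ y) x
      = c * momentum B j φ x + d * momentum B j ψ x := by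
  have h : HasFDerivAt (fun y => c * φ y + d * ψ y) _ x :=
    (hφ.hasFDerivAt.const_mul c).add (hψ.hasFDerivAt.const_mul d)
  simp only [momentum, h.fderiv]
  simp only [FunLike.coe_smul, add_apply, Pi.smul_apply,
    smul_eq_mul]
  ring

/-- The Landau eigenvalue equation. -/
theorem landauExpr_landauFun (B : ℝ) (n m : ℕ) (x : Plane) :
    landauExpr B (landauFun (B / 2) n m) x = (B * (2 * n + 1) : ℝ) * landauFun (B / 2) n m x := by
  have hd : ∀ k, DifferentiableAt ℝ (landauFun (B / 2) k m) x := fun k =>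
    (hasFDerivAt_landauFun _ k m x).differentiableAt
  have e0 : momentum B 0 (landauFun (B / 2) n m) = fun y =>
      Complex.I * landauFun (B / 2) (n + 1) m y
        + (-Complex.I * n * (B / 2)) * landauFun (B / 2) (n - 1) m y := by
    funext y
    rw [momentum_zero_landauFun]
    ring
  have e1 : momentum B 1 (landauFun (B / 2) n m) = fun y =>
      1 * landauFun (B / 2) (n + 1) m y
        + (n * (B / 2)) * landauFun (B / 2) (n - 1) m y := by
    funext y
    rw [momentum_one_landauFun]
    ring
  have e3 : (n : ℂ) * landauFun (B / 2) (n - 1 + 1) m x = n * landauFun (B / 2) n m x := by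
    cases n <;> simp
  -- The sum of squares is `2 (a† a + a a†)`, with value `2 (B / 2) (n + (n + 1))`.
  rw [landauExpr, Fin.sum_univ_two, e0, e1, momentum_add_smul B 0 _ _ (hd _) (hd _),
    momentum_add_smul B 1 _ _ (hd _) (hd _), momentum_zero_landauFun, momentum_zero_landauFun,
    momentum_one_landauFun, momentum_one_landauFun, Nat.add_sub_cancel]
  push_cast
  linear_combination B * e3 + (landauFun (B / 2) (n + 1 + 1) m x
    - (n + 1) * (B / 2) * landauFun (B / 2) n m x
    - n * (B / 2) * (landauFun (B / 2) (n - 1 + 1) m x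
      - (n - 1 : ℕ) * (B / 2) * landauFun (B / 2) (n - 1 - 1) m x)) * Complex.I_sq

/-! ### Formal symmetry of the Landau expression. -/

theorem integral_conj_momentum_mul (B : ℝ) (j : Fin 2) {φ χ : Plane → ℂ} (hφ : ContDiff ℝ ∞ φ)
    (hφc : HasCompactSupport φ) (hχ : ContDiff ℝ ∞ χ) :
    ∫ x, starRingEnd ℂ (momentum B j φ x) * χ x
      = ∫ x, starRingEnd ℂ (φ x) * momentum B j χ x := by
  set v : Plane := EuclideanSpace.single j 1
  set ψ : Plane → ℂ := fun x => starRingEnd ℂ (φ x) with hψ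
  have hψd : ∀ x, HasFDerivAt ψ (Complex.conjCLE.toContinuousLinearMap ∘L fderiv ℝ φ x) x :=
    fun x => (Complex.conjCLE.toContinuousLinearMap.hasFDerivAt).comp x
      ((hφ.differentiable (by simp)) x).hasFDerivAt
  have hψ1 : ContDiff ℝ ∞ ψ :=
    Complex.conjCLE.toContinuousLinearMap.contDiff.comp (g := Complex.conjCLE) hφ
  have hψc : HasCompactSupport ψ := hφc.comp_left (g := starRingEnd ℂ) (by simp)
  have hψ' : ∀ x, fderiv ℝ ψ x v = starRingEnd ℂ (fderiv ℝ φ x v) := fun x => by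
    rw [(hψd x).fderiv]
    rfl
  have c1 : Continuous fun x => fderiv ℝ ψ x v :=
    (hψ1.continuous_fderiv (by simp)).clm_apply continuous_const
  have c2 : Continuous fun x => fderiv ℝ χ x v :=
    (hχ.continuous_fderiv (by simp)).clm_apply continuous_const
  have s1 : HasCompactSupport fun x => fderiv ℝ ψ x v := hψc.fderiv_apply (𝕜 := ℝ) v
  have i1 : Integrable fun x => fderiv ℝ ψ x v * χ x :=
    (c1.mul hχ.continuous).integrable_of_hasCompactSupport s1.mul_right
  have i2 : Integrable fun x => ψ x * fderiv ℝ χ x v :=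
    (hψ1.continuous.mul c2).integrable_of_hasCompactSupport hψc.mul_right
  have i3 : Integrable fun x => ψ x * χ x :=
    (hψ1.continuous.mul hχ.continuous).integrable_of_hasCompactSupport hψc.mul_right
  have i4 : Integrable fun x => (vecPot B j x : ℂ) * (ψ x * χ x) :=
    ((contDiff_vecPot B j).continuous.mul
      (hψ1.continuous.mul hχ.continuous)).integrable_of_hasCompactSupport hψc.mul_right.mul_left
  have parts : ∫ x, ψ x * fderiv ℝ χ x v = -∫ x, fderiv ℝ ψ x v * χ x :=
    integral_mul_fderiv_eq_neg_fderiv_mul_of_integrable i1 i2 i3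
      (fun x _ => (hψ1.differentiable (by simp)) x) (fun x _ => (hχ.differentiable (by simp)) x)
  have l : ∀ x, starRingEnd ℂ (momentum B j φ x) * χ x
      = Complex.I * (fderiv ℝ ψ x v * χ x) - (vecPot B j x : ℂ) * (ψ x * χ x) := fun x => by
    rw [hψ', momentum]
    simp only [map_sub, map_mul, map_neg, Complex.conj_I, Complex.conj_ofReal]
    ring
  have r : ∀ x, starRingEnd ℂ (φ x) * momentum B j χ x
      = -Complex.I * (ψ x * fderiv ℝ χ x v) - (vecPot B j x : ℂ) * (ψ x * χ x) := fun x => by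
    rw [momentum]
    ring
  simp_rw [l, r]
  rw [integral_sub (i1.const_mul _) i4, integral_sub (i2.const_mul _) i4, integral_const_mul,
    integral_const_mul, parts]
  ring

/-- Each momentum component is moved across twice. The compact support of `φ` makes all integrals
converge, so `χ` may be an eigenfunction without compact support. -/
theorem integral_conj_landauExpr_mul (B : ℝ) {φ χ : Plane → ℂ} (hφ : ContDiff ℝ ∞ φ)
    (hφc : HasCompactSupport φ) (hχ : ContDiff ℝ ∞ χ) :
    ∫ x, starRingEnd ℂ (landauExpr B φ x) * χ x
      = ∫ x, starRingEnd ℂ (φ x) * landauExpr B χ x := by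
  simp only [landauExpr, map_sum, Finset.sum_mul, Finset.mul_sum]
  rw [integral_finsetSum, integral_finsetSum]
  · refine Finset.sum_congr rfl fun j _ => ?_
    rw [integral_conj_momentum_mul B j (contDiff_momentum B j hφ)
      (hasCompactSupport_momentum B j hφc) hχ,
      integral_conj_momentum_mul B j hφ hφc (contDiff_momentum B j hχ)]
  · intro j _
    refine Continuous.integrable_of_hasCompactSupport ?_ ?_
    · exact (Complex.continuous_conj.comp hφ.continuous).mul
        (contDiff_momentum B j (contDiff_momentum B j hχ)).continuous
    · exact (hφc.comp_left (g := starRingEnd ℂ) (by simp)).mul_right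
  · intro j _
    refine Continuous.integrable_of_hasCompactSupport ?_ ?_
    · exact (Complex.continuous_conj.comp
        (contDiff_momentum B j (contDiff_momentum B j hφ)).continuous).mul hχ.continuous
    · exact ((hasCompactSupport_momentum B j (hasCompactSupport_momentum B j hφc)).comp_left
        (g := starRingEnd ℂ) (by simp)).mul_right

/-! ### Decay of the Landau eigenfunctions -/

/-- Each step of the recursion multiplies the bound by at most `β R + m ≤ (β R + 1) (m + 1)`. For
fixed `n` the growth in `m` is only exponential, which a factorial will beat. -/
theorem norm_landauPoly_le {β R : ℝ} (hβ : 0 < β) (hR : 1 ≤ R) (n m : ℕ) {x : Plane}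
    (hx : ‖x‖ ≤ R) : ‖landauPoly β n m x‖ ≤ (β * R + 1) ^ n * (m + 1) ^ n * R ^ m := by
  have hR0 : 0 ≤ R := zero_le_one.trans hR
  induction n generalizing m with
  | zero =>
    rw [landauPoly_zero, norm_pow, norm_zbL]
    simpa using pow_le_pow_left₀ (norm_nonneg x) hx m
  | succ n ih =>
    set A := (β * R + 1) ^ n * ((m : ℝ) + 1) ^ n * R ^ m
    have hA : 0 ≤ A := by positivity
    have h1 : ‖(β : ℂ) * zL x * landauPoly β n m x‖ ≤ β * R * A := by
      rw [norm_mul, norm_mul, norm_zL, Complex.norm_real, Real.norm_of_nonneg hβ.le]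
      gcongr
      exact ih m
    have h2 : ‖(m : ℂ) * landauPoly β n (m - 1) x‖ ≤ m * A := by
      rw [norm_mul, Complex.norm_natCast]
      gcongr
      refine (ih (m - 1)).trans ?_
      have : ((m - 1 : ℕ) : ℝ) ≤ m := by exact_mod_cast Nat.sub_le m 1
      have : R ^ (m - 1) ≤ R ^ m := pow_le_pow_right₀ hR (Nat.sub_le m 1)
      simp only [A]
      gcongr
    rw [landauPoly_succ]
    calc ‖(β : ℂ) * zL x * landauPoly β n m x - m * landauPoly β n (m - 1) x‖
        ≤ β * R * A + m * A := (norm_sub_le _ _).trans (add_le_add h1 h2)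
      _ ≤ (β * R + 1) * (m + 1) * A := by
        have : 0 ≤ β * R * m * A := by positivity
        nlinarith
      _ = _ := by simp only [A]; ring

theorem norm_gauss (β : ℝ) (x : Plane) : ‖gauss β x‖ = Real.exp (-(β / 2) * ‖x‖ ^ 2) := by
  rw [gauss_eq, Complex.norm_real, Real.norm_of_nonneg (Real.exp_pos _).le]

/-- Half of the Gaussian absorbs the polynomial and the weight. The weight is needed to dominate the
exponential series in the completeness proof. -/
theorem exp_mul_norm_landauFun_le {β : ℝ} (hβ : 0 < β) (c : ℝ) (n m : ℕ) :
    ∃ C : ℝ, ∀ x : Plane, Real.exp (c * ‖x‖) * ‖landauFun β n m x‖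
      ≤ C * Real.exp (-(β / 4) * ‖x‖ ^ 2) := by
  refine ⟨(β + 1) ^ n * (m + 1) ^ n * ((n + m).factorial * Real.exp 1)
    * Real.exp ((c + 1) ^ 2 / β), fun x => ?_⟩
  set t := ‖x‖ with ht
  have ht0 : 0 ≤ t := norm_nonneg x
  have h1 : ‖landauPoly β n m x‖
      ≤ (β + 1) ^ n * (m + 1) ^ n * ((n + m).factorial * (Real.exp 1 * Real.exp t)) := by
    have h2 := norm_landauPoly_le hβ (by linarith : 1 ≤ 1 + t) n m (by linarith : ‖x‖ ≤ 1 + t)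
    have h3 : (β * (1 + t) + 1) ^ n ≤ ((β + 1) * (1 + t)) ^ n := by
      gcongr
      nlinarith
    have h4 : (1 + t) ^ (n + m) ≤ (n + m).factorial * (Real.exp 1 * Real.exp t) := by
      have := Real.pow_div_factorial_le_exp (1 + t) (by linarith) (n + m)
      rw [div_le_iff₀ (by positivity), Real.exp_add] at this
      linarith
    calc ‖landauPoly β n m x‖ ≤ _ := h2
      _ ≤ ((β + 1) * (1 + t)) ^ n * (m + 1) ^ n * (1 + t) ^ m := by gcongr
      _ = (β + 1) ^ n * (m + 1) ^ n * (1 + t) ^ (n + m) := by rw [mul_pow, pow_add]; ring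
      _ ≤ _ := by gcongr
  have h5 : Real.exp (c * t) * (Real.exp t * Real.exp (-(β / 2) * t ^ 2))
      ≤ Real.exp ((c + 1) ^ 2 / β) * Real.exp (-(β / 4) * t ^ 2) := by
    rw [← Real.exp_add, ← Real.exp_add, ← Real.exp_add, Real.exp_le_exp]
    -- Completing the square; the `1` in `c + 1` accounts for the polynomial, bounded by a multiple
    -- of `exp t`.
    have h6 : (c + 1) * t ≤ (c + 1) ^ 2 / β + β / 4 * t ^ 2 := by
      have h7 : (c + 1) ^ 2 / β + β / 4 * t ^ 2 - (c + 1) * t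
          = (c + 1 - β / 2 * t) ^ 2 / β := by
        field_simp
        ring
      have : 0 ≤ (c + 1 - β / 2 * t) ^ 2 / β := by positivity
      linarith
    linarith
  rw [landauFun, norm_mul, norm_gauss]
  calc Real.exp (c * t) * (‖landauPoly β n m x‖ * Real.exp (-(β / 2) * t ^ 2))
      ≤ Real.exp (c * t) * ((β + 1) ^ n * (m + 1) ^ n
        * ((n + m).factorial * (Real.exp 1 * Real.exp t)) * Real.exp (-(β / 2) * t ^ 2)) := by
        gcongr
    _ = (β + 1) ^ n * (m + 1) ^ n * ((n + m).factorial * Real.exp 1)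
        * (Real.exp (c * t) * (Real.exp t * Real.exp (-(β / 2) * t ^ 2))) := by ring
    _ ≤ (β + 1) ^ n * (m + 1) ^ n * ((n + m).factorial * Real.exp 1)
        * (Real.exp ((c + 1) ^ 2 / β) * Real.exp (-(β / 4) * t ^ 2)) := by gcongr
    _ = _ := by ring

theorem memLp_gaussian {b : ℝ} (hb : 0 < b) :
    MemLp (fun x : Plane => Real.exp (-b * ‖x‖ ^ 2)) 2 := by
  rw [memLp_two_iff_integrable_sq (by fun_prop)]
  have h := (GaussianFourier.integrable_cexp_neg_mul_sq_norm_add (V := Plane) (b := (2 * b : ℝ))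
    (by simpa using hb) 0 0).re
  refine h.congr (Filter.Eventually.of_forall fun x => ?_)
  have e : (-((2 * b : ℝ) : ℂ) * (‖x‖ : ℂ) ^ 2 + 0 * ((⟪(0 : Plane), x⟫_ℝ : ℝ) : ℂ))
      = ((2 * (-b * ‖x‖ ^ 2) : ℝ) : ℂ) := by
    push_cast
    ring
  simp only [e]
  rw [← Complex.ofReal_exp, RCLike.re_to_complex, Complex.ofReal_re, ← Real.exp_nat_mul,
    Nat.cast_ofNat]

theorem memLp_exp_mul_landauFun {β : ℝ} (hβ : 0 < β) (c : ℝ) (n m : ℕ) :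
    MemLp (fun x : Plane => (Real.exp (c * ‖x‖) : ℂ) * landauFun β n m x) 2 := by
  obtain ⟨C, hC⟩ := exp_mul_norm_landauFun_le hβ c n m
  refine ((memLp_gaussian (by positivity : 0 < β / 4)).const_mul C).of_le ?_ ?_
  · refine Continuous.aestronglyMeasurable (Continuous.mul ?_ (contDiff_landauFun β n m).continuous)
    fun_prop
  · refine Filter.Eventually.of_forall fun x => ?_
    rw [norm_mul, Complex.norm_real, Real.norm_of_nonneg (Real.exp_pos _).le]
    exact (hC x).trans (le_abs_self _)

theorem memLp_landauFun {β : ℝ} (hβ : 0 < β) (n m : ℕ) : MemLp (landauFun β n m) 2 := by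
  simpa using memLp_exp_mul_landauFun hβ 0 n m

/-! ### Orthogonality relations -/

/-- The integral of every directional derivative vanishes, by parts against the constant `1`. The
two coordinate directions separate the integrals of `∂_z u` and `∂_z̄ u`. -/
theorem integral_wirtinger_eq_zero {u a b : Plane → ℂ}
    (h : ∀ x, HasFDerivAt u (a x • zL + b x • zbL) x) (hu : Integrable u) (ha : Integrable a)
    (hb : Integrable b) : ∫ x, a x = 0 := by
  have hv : ∀ v, (∫ x, a x) * zL v + (∫ x, b x) * zbL v = 0 := by
    intro v
    have e : ∀ x, fderiv ℝ u x v = a x * zL v + b x * zbL v := fun x => by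
      rw [(h x).fderiv]
      rfl
    have hi : Integrable fun x => fderiv ℝ u x v := by
      simp_rw [e]
      exact (ha.mul_const _).add (hb.mul_const _)
    have := integral_mul_fderiv_eq_neg_fderiv_mul_of_integrable (μ := (volume : Measure Plane))
      (f := fun _ => (1 : ℂ)) (g := u) (v := v) (by simp) (by simpa using hi) (by simpa using hu)
      (fun x _ => differentiableAt_const _) (fun x _ => (h x).differentiableAt)
    simp only [one_mul, fderiv_fun_const, Pi.zero_apply, zero_apply, zero_mul,
      integral_zero, neg_zero] at this
    simp_rw [e] at this
    rwa [integral_add (ha.mul_const _) (hb.mul_const _), integral_mul_const,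
      integral_mul_const] at this
  have h0 := hv (EuclideanSpace.single 0 1)
  have h1 := hv (EuclideanSpace.single 1 1)
  rw [zL_single_zero, zbL_single_zero] at h0
  rw [zL_single_one, zbL_single_one] at h1
  linear_combination (1 / 2) * h0 - (Complex.I / 2) * h1
    + (1 / 2) * ((∫ x, a x) - ∫ x, b x) * Complex.I_sq

theorem integrable_conj_landauFun_mul {β : ℝ} (hβ : 0 < β) (n m k l : ℕ) :
    Integrable fun x => starRingEnd ℂ (landauFun β n m x) * landauFun β k l x :=
  (memLp_landauFun hβ n m).star.integrable_mul (memLp_landauFun hβ k l)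

section

variable {β : ℝ} (hβ : 0 < β)

/-- The (unnormalised) Landau eigenfunctions as elements of `L²`. -/
def landauVec (n m : ℕ) : L2 := (memLp_landauFun hβ n m).toLp

theorem inner_landauVec (n m k l : ℕ) :
    ⟪landauVec hβ n m, landauVec hβ k l⟫_ℂ
      = ∫ x, starRingEnd ℂ (landauFun β n m x) * landauFun β k l x := by
  rw [landauVec, ← integral_conj_mul]
  refine integral_congr_ae ?_
  filter_upwards [(memLp_landauFun hβ k l).coeFn_toLp] with x hx
  rw [landauVec, hx]

/-- Adjointness of raising and lowering in each index. One equation (`e1`) evaluates `β ∫ z̄ f̄ g`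
with `z̄` attached to either factor, the other (`e2`) is `∫ ∂_z (f̄ g) = 0`; both relations are
linear combinations of these. -/
theorem inner_landauVec_relations (n m k l : ℕ) :
    ⟪landauVec hβ (n + 1) m, landauVec hβ k l⟫_ℂ
        = β * k * ⟪landauVec hβ n m, landauVec hβ (k - 1) l⟫_ℂ ∧
      β * ⟪landauVec hβ n m, landauVec hβ k (l + 1)⟫_ℂ
        = m * ⟪landauVec hβ n (m - 1), landauVec hβ k l⟫_ℂ := by
  simp only [inner_landauVec]
  have I := integrable_conj_landauFun_mul hβ
  have e1 : ∫ x, (starRingEnd ℂ (landauFun β (n + 1) m x) * landauFun β k l x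
        + m * (starRingEnd ℂ (landauFun β n (m - 1) x) * landauFun β k l x))
      = ∫ x, (β * (starRingEnd ℂ (landauFun β n m x) * landauFun β k (l + 1) x)
        + β * k * (starRingEnd ℂ (landauFun β n m x) * landauFun β (k - 1) l x)) := by
    refine integral_congr_ae (Filter.Eventually.of_forall fun x => ?_)
    have h1 := congrArg (starRingEnd ℂ) (zL_mul_landauFun β n m x)
    have h2 := zbL_mul_landauFun β k l x
    simp only [map_mul, map_add, Complex.conj_ofReal, Complex.conj_natCast, conj_zL] at h1
    simp only
    linear_combination -landauFun β k l x * h1 + β * starRingEnd ℂ (landauFun β n m x) * h2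
  have hd : ∀ x, HasFDerivAt (fun x => starRingEnd ℂ (landauFun β n m x) * landauFun β k l x)
      ((1 / 2 * (m * (starRingEnd ℂ (landauFun β n (m - 1) x) * landauFun β k l x)
          - starRingEnd ℂ (landauFun β (n + 1) m x) * landauFun β k l x)
        + β / 2 * (k * (starRingEnd ℂ (landauFun β n m x) * landauFun β (k - 1) l x)
          - starRingEnd ℂ (landauFun β n m x) * landauFun β k (l + 1) x)) • zL
      + (β / 2 * (n * (starRingEnd ℂ (landauFun β (n - 1) m x) * landauFun β k l x)
          - starRingEnd ℂ (landauFun β n (m + 1) x) * landauFun β k l x)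
        + 1 / 2 * (l * (starRingEnd ℂ (landauFun β n m x) * landauFun β k (l - 1) x)
          - starRingEnd ℂ (landauFun β n m x) * landauFun β (k + 1) l x)) • zbL) x := by
    intro x
    have hc : HasFDerivAt (fun x => starRingEnd ℂ (landauFun β n m x)) _ x :=
      (Complex.conjCLE.toContinuousLinearMap.hasFDerivAt).comp x (hasFDerivAt_landauFun β n m x)
    refine (hc.mul (hasFDerivAt_landauFun β k l x)).congr_fderiv ?_
    ext v
    simp only [FunLike.coe_smul, add_apply, Pi.smul_apply, smul_eq_mul,
      ContinuousLinearMap.coe_comp, Function.comp_apply, ContinuousLinearEquiv.coe_coe,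
      Complex.conjCLE_apply, map_add, map_mul, map_sub, conj_zL, conj_zbL, map_div₀,
      Complex.conj_ofReal, Complex.conj_natCast, map_one, map_ofNat]
    ring
  have e2 := integral_wirtinger_eq_zero hd (I n m k l)
    (((((I n (m - 1) k l).const_mul (m : ℂ)).sub (I (n + 1) m k l)).const_mul (1 / 2)).add
      ((((I n m (k - 1) l).const_mul (k : ℂ)).sub (I n m k (l + 1))).const_mul (β / 2 : ℂ)))
    (((((I (n - 1) m k l).const_mul (n : ℂ)).sub (I n (m + 1) k l)).const_mul (β / 2 : ℂ)).add
      ((((I n m k (l - 1)).const_mul (l : ℂ)).sub (I n m (k + 1) l)).const_mul (1 / 2)))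
  rw [integral_add, integral_const_mul, integral_const_mul, integral_sub, integral_sub,
    integral_const_mul, integral_const_mul] at e2
  rotate_left
  · exact (I n m (k - 1) l).const_mul (k : ℂ)
  · exact I n m k (l + 1)
  · exact (I n (m - 1) k l).const_mul (m : ℂ)
  · exact I (n + 1) m k l
  · exact (((I n (m - 1) k l).const_mul (m : ℂ)).sub (I (n + 1) m k l)).const_mul (1 / 2)
  · exact (((I n m (k - 1) l).const_mul (k : ℂ)).sub (I n m k (l + 1))).const_mul (β / 2 : ℂ)
  rw [integral_add (I _ _ _ _) ((I _ _ _ _).const_mul _), integral_add ((I _ _ _ _).const_mul _)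
    ((I _ _ _ _).const_mul _), integral_const_mul, integral_const_mul, integral_const_mul] at e1
  constructor
  · linear_combination (1 / 2) * e1 - e2
  · linear_combination -(1 / 2) * e1 - e2

theorem inner_landauVec_succ_left (n m k l : ℕ) :
    ⟪landauVec hβ (n + 1) m, landauVec hβ k l⟫_ℂ
        = β * k * ⟪landauVec hβ n m, landauVec hβ (k - 1) l⟫_ℂ :=
  (inner_landauVec_relations hβ n m k l).1

theorem inner_landauVec_succ_right (n m k l : ℕ) :
    β * ⟪landauVec hβ n m, landauVec hβ k (l + 1)⟫_ℂ
        = m * ⟪landauVec hβ n (m - 1), landauVec hβ k l⟫_ℂ :=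
  (inner_landauVec_relations hβ n m k l).2

theorem inner_landauVec_eq_zero_of_ne_left {n k : ℕ} (h : n ≠ k) (m l : ℕ) :
    ⟪landauVec hβ n m, landauVec hβ k l⟫_ℂ = 0 := by
  induction n generalizing k with
  | zero =>
    obtain ⟨k, rfl⟩ := Nat.exists_eq_succ_of_ne_zero h.symm
    rw [← inner_conj_symm, Nat.succ_eq_add_one, inner_landauVec_succ_left]
    simp
  | succ n ih =>
    rw [inner_landauVec_succ_left]
    cases k with
    | zero => simp
    | succ k => rw [Nat.add_sub_cancel, ih (fun e => h (by rw [e])), mul_zero]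

theorem inner_landauVec_eq_zero_of_ne_right {m l : ℕ} (h : m ≠ l) (n k : ℕ) :
    ⟪landauVec hβ n m, landauVec hβ k l⟫_ℂ = 0 := by
  have hβ' : (β : ℂ) ≠ 0 := by exact_mod_cast hβ.ne'
  induction l generalizing m with
  | zero =>
    obtain ⟨m, rfl⟩ := Nat.exists_eq_succ_of_ne_zero h
    have := inner_landauVec_succ_right hβ k 0 n m
    rw [Nat.cast_zero, zero_mul, mul_eq_zero, or_iff_right hβ'] at this
    rw [← inner_conj_symm, Nat.succ_eq_add_one, this, map_zero]
  | succ l ih =>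
    have := inner_landauVec_succ_right hβ n m k l
    refine (mul_eq_zero.mp (this.trans ?_)).resolve_left hβ'
    cases m with
    | zero => simp
    | succ m => rw [Nat.add_sub_cancel, ih (fun e => h (by rw [e])), mul_zero]

/-- The ladder relations on the diagonal are recursions for the norms. The factor `m! / β ^ m` is
the source of the decay of the localized eigenfunctions. -/
theorem norm_sq_landauVec (n m : ℕ) :
    ‖landauVec hβ n m‖ ^ 2
      = β ^ n * n.factorial * (m.factorial / β ^ m) * ‖landauVec hβ 0 0‖ ^ 2 := by
  have key : ∀ n m, ⟪landauVec hβ n m, landauVec hβ n m⟫_ℂ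
      = ((‖landauVec hβ n m‖ ^ 2 : ℝ) : ℂ) := fun n m => by
    rw [inner_self_eq_norm_sq_to_K]
    norm_cast
  have h1 : ∀ n m, ‖landauVec hβ (n + 1) m‖ ^ 2 = β * (n + 1) * ‖landauVec hβ n m‖ ^ 2 := by
    intro n m
    have := inner_landauVec_succ_left hβ n m (n + 1) m
    rw [Nat.add_sub_cancel, key, key] at this
    exact_mod_cast this
  have h2 : ∀ m, ‖landauVec hβ 0 (m + 1)‖ ^ 2 = (m + 1) / β * ‖landauVec hβ 0 m‖ ^ 2 := by
    intro m
    have := inner_landauVec_succ_right hβ 0 (m + 1) 0 m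
    rw [Nat.add_sub_cancel, key, key] at this
    have h : β * ‖landauVec hβ 0 (m + 1)‖ ^ 2 = (m + 1) * ‖landauVec hβ 0 m‖ ^ 2 := by
      exact_mod_cast this
    field_simp
    linarith
  induction n with
  | zero =>
    induction m with
    | zero => simp
    | succ m ih =>
      rw [h2, ih, Nat.factorial_succ]
      push_cast
      field_simp
      ring
  | succ n ih =>
    rw [h1, ih, Nat.factorial_succ]
    push_cast
    ring

theorem landauVec_zero_ne_zero : landauVec hβ 0 0 ≠ 0 := by
  intro h
  have h1 : landauVec hβ 0 0 =ᵐ[volume] landauFun β 0 0 := (memLp_landauFun hβ 0 0).coeFn_toLp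
  rw [h] at h1
  have h2 : landauFun β 0 0 = fun _ => 0 :=
    ((contDiff_landauFun β 0 0).continuous.ae_eq_iff_eq (μ := volume) continuous_const).mp
      (h1.symm.trans (Lp.coeFn_zero ℂ 2 volume))
  have h3 := congrFun h2 0
  simp [landauFun, landauPoly_zero, gauss] at h3

end

/-! ### Completeness of the Landau eigenfunctions -/

open scoped FourierTransform SchwartzMap in
/-- The Fourier transform is injective on `L¹`. -/
theorem ae_eq_zero_of_fourier_eq_zero {V : Type*} [NormedAddCommGroup V] [InnerProductSpace ℝ V]
    [FiniteDimensional ℝ V] [MeasurableSpace V] [BorelSpace V] {h : V → ℂ} (hi : Integrable h)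
    (hF : ∀ w, 𝓕 h w = 0) : ∀ᵐ x, h x = 0 := by
  refine ae_eq_zero_of_integral_contDiff_smul_eq_zero hi.locallyIntegrable fun g hg hgc => ?_
  have h1 : ContDiff ℝ ∞ (fun x => (g x : ℂ)) :=
    Complex.ofRealCLM.contDiff.comp (g := Complex.ofRealCLM) hg
  have h2 : HasCompactSupport (fun x => (g x : ℂ)) :=
    hgc.comp_left (g := fun t : ℝ => (t : ℂ)) (by simp)
  set G : 𝓢(V, ℂ) := h2.toSchwartzMap h1 with hG
  -- The test function is the Fourier transform of `𝓕⁻ G`, and the transform is moved onto `h`.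
  have hflip : ∫ ξ, 𝓕 (𝓕⁻ G : 𝓢(V, ℂ)) ξ • h ξ = ∫ x, (𝓕⁻ G : 𝓢(V, ℂ)) x • 𝓕 h x := by
    have := VectorFourier.integral_fourierIntegral_smul_eq_flip (L := innerₗ V)
      Real.continuous_fourierChar continuous_inner
      ((𝓕⁻ G : 𝓢(V, ℂ)).integrable (μ := volume)) hi
    rw [flip_innerₗ] at this
    exact this
  rw [FourierTransform.fourier_fourierInv_eq] at hflip
  simp only [hF, smul_zero, integral_zero] at hflip
  rw [← hflip]
  refine integral_congr_ae (Filter.Eventually.of_forall fun x => ?_)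
  simp [hG, Complex.real_smul]

/-- The span of the Landau eigenfunctions, a space of functions. -/
def landauSpan (β : ℝ) : Submodule ℂ (Plane → ℂ) :=
  Submodule.span ℂ (Set.range fun p : ℕ × ℕ => landauFun β p.1 p.2)

theorem landauFun_mem_landauSpan (β : ℝ) (n m : ℕ) : landauFun β n m ∈ landauSpan β :=
  Submodule.subset_span ⟨(n, m), rfl⟩

theorem mul_mem_landauSpan {β : ℝ} {q : Plane → ℂ}
    (hq : ∀ n m, q * landauFun β n m ∈ landauSpan β) {F : Plane → ℂ} (hF : F ∈ landauSpan β) :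
    q * F ∈ landauSpan β := by
  have : landauSpan β ≤ (landauSpan β).comap (LinearMap.mulLeft ℂ q) := by
    rw [landauSpan, Submodule.span_le]
    rintro _ ⟨p, rfl⟩
    exact hq p.1 p.2
  exact this hF

theorem zL_mul_mem_landauSpan {β : ℝ} (hβ : 0 < β) {F : Plane → ℂ} (hF : F ∈ landauSpan β) :
    ⇑zL * F ∈ landauSpan β := by
  refine mul_mem_landauSpan (fun n m => ?_) hF
  have hβ' : (β : ℂ) ≠ 0 := by exact_mod_cast hβ.ne'
  have e : ⇑zL * landauFun β n m
      = (β : ℂ)⁻¹ • (landauFun β (n + 1) m + (m : ℂ) • landauFun β n (m - 1)) := by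
    funext x
    simp only [Pi.mul_apply, Pi.smul_apply, Pi.add_apply, smul_eq_mul, ← zL_mul_landauFun]
    field_simp
  rw [e]
  exact Submodule.smul_mem _ _ (Submodule.add_mem _ (landauFun_mem_landauSpan _ _ _)
    (Submodule.smul_mem _ _ (landauFun_mem_landauSpan _ _ _)))

theorem zbL_mul_mem_landauSpan {β : ℝ} {F : Plane → ℂ} (hF : F ∈ landauSpan β) :
    ⇑zbL * F ∈ landauSpan β := by
  refine mul_mem_landauSpan (fun n m => ?_) hF
  have e : ⇑zbL * landauFun β n m
      = landauFun β n (m + 1) + (n : ℂ) • landauFun β (n - 1) m := by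
    funext x
    simp only [Pi.mul_apply, Pi.smul_apply, Pi.add_apply, smul_eq_mul, ← zbL_mul_landauFun]
  rw [e]
  exact Submodule.add_mem _ (landauFun_mem_landauSpan _ _ _)
    (Submodule.smul_mem _ _ (landauFun_mem_landauSpan _ _ _))

/-- `⟨x, w⟩` is a linear combination of `z` and `z̄`, and the span is stable under multiplication by
both. -/
theorem inner_pow_mul_gauss_mem_landauSpan {β : ℝ} (hβ : 0 < β) (w : Plane) (k : ℕ) :
    (fun x => (⟪x, w⟫_ℝ : ℂ) ^ k * gauss β x) ∈ landauSpan β := by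
  induction k with
  | zero =>
    have e : (fun x : Plane => (⟪x, w⟫_ℝ : ℂ) ^ 0 * gauss β x) = landauFun β 0 0 := by
      funext x
      simp [landauFun, landauPoly_zero]
    rw [e]
    exact landauFun_mem_landauSpan _ _ _
  | succ k ih =>
    set F : Plane → ℂ := fun x => (⟪x, w⟫_ℝ : ℂ) ^ k * gauss β x
    have e : (fun x : Plane => (⟪x, w⟫_ℝ : ℂ) ^ (k + 1) * gauss β x)
        = ((w 0 - Complex.I * w 1) / 2) • (⇑zL * F)
          + ((w 0 + Complex.I * w 1) / 2) • (⇑zbL * F) := by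
      funext x
      have hi : (⟪x, w⟫_ℝ : ℂ) = x 0 * w 0 + x 1 * w 1 := by
        rw [PiLp.inner_apply, Fin.sum_univ_two]
        simp [mul_comm]
      simp only [Pi.add_apply, Pi.smul_apply, Pi.mul_apply, smul_eq_mul, zL_apply, zbL_apply, F,
        pow_succ]
      linear_combination (⟪x, w⟫_ℝ : ℂ) ^ k * gauss β x * (hi + x 1 * w 1 * Complex.I_sq)
    rw [e]
    exact Submodule.add_mem _ (Submodule.smul_mem _ _ (zL_mul_mem_landauSpan hβ ih))
      (Submodule.smul_mem _ _ (zbL_mul_mem_landauSpan ih))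

theorem integral_conj_mul_eq_zero_of_mem_landauSpan {β : ℝ} (hβ : 0 < β) {u : L2}
    (hu : ∀ n m, ⟪landauVec hβ n m, u⟫_ℂ = 0) {F : Plane → ℂ} (hF : F ∈ landauSpan β) :
    MemLp F 2 ∧ ∫ x, starRingEnd ℂ (F x) * u x = 0 := by
  induction hF using Submodule.span_induction with
  | mem F hF =>
    obtain ⟨p, rfl⟩ := hF
    exact ⟨memLp_landauFun hβ p.1 p.2,
      (integral_conj_mul (memLp_landauFun hβ p.1 p.2) u).trans (hu p.1 p.2)⟩
  | zero => exact ⟨MemLp.zero, by simp⟩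
  | add F G _ _ hF hG =>
    refine ⟨hF.1.add hG.1, ?_⟩
    simp only [Pi.add_apply, map_add, add_mul]
    have hF' : Integrable fun x => starRingEnd ℂ (F x) * u x :=
      hF.1.star.integrable_mul (Lp.memLp u)
    have hG' : Integrable fun x => starRingEnd ℂ (G x) * u x :=
      hG.1.star.integrable_mul (Lp.memLp u)
    rw [integral_add hF' hG', hF.2, hG.2, add_zero]
  | smul c F _ hF =>
    refine ⟨hF.1.const_smul c, ?_⟩
    simp only [Pi.smul_apply, smul_eq_mul, map_mul, mul_assoc]
    rw [integral_const_mul, hF.2, mul_zero]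

/-- The Fourier transform of `gauss β * u` is expanded in powers of `⟨x, w⟩`. Each term vanishes by
orthogonality, so the product is zero by injectivity, and the Gaussian has no zeros. -/
theorem eq_zero_of_inner_landauVec_eq_zero {β : ℝ} (hβ : 0 < β) {u : L2}
    (hu : ∀ n m, ⟪landauVec hβ n m, u⟫_ℂ = 0) : u = 0 := by
  have hgm : MemLp (gauss β) 2 := by
    have := memLp_landauFun hβ 0 0
    have e : landauFun β 0 0 = gauss β := by
      funext x
      simp [landauFun, landauPoly_zero]
    rwa [e] at this
  have hconj : ∀ x, starRingEnd ℂ (gauss β x) = gauss β x := fun x => by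
    rw [gauss_eq, Complex.conj_ofReal]
  have hi : Integrable fun x => gauss β x * u x := hgm.integrable_mul (Lp.memLp u)
  have hF : ∀ w, FourierTransform.fourier (fun x => gauss β x * u x) w = 0 := by
    intro w
    set ℓ : Plane → ℝ := fun x => -2 * Real.pi * ⟪x, w⟫_ℝ with hℓ
    have hℓc : Continuous ℓ := by fun_prop
    have hb : ∀ x, |ℓ x| ≤ 2 * Real.pi * ‖w‖ * ‖x‖ := fun x => by
      have h1 := abs_real_inner_le_norm x w
      have h2 : |ℓ x| = 2 * Real.pi * |⟪x, w⟫_ℝ| := by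
        rw [hℓ]
        simp only [abs_mul, abs_neg, abs_of_pos Real.pi_pos, abs_two]
      rw [h2]
      have := mul_le_mul_of_nonneg_left h1 (by positivity : 0 ≤ 2 * Real.pi)
      linarith
    have hzero : ∀ k : ℕ, ∫ x, ((ℓ x : ℂ) * Complex.I) ^ k / k.factorial * (gauss β x * u x)
        = 0 := by
      intro k
      have h1 := (integral_conj_mul_eq_zero_of_mem_landauSpan hβ hu
        (inner_pow_mul_gauss_mem_landauSpan hβ w k)).2
      have e : ∀ x, ((ℓ x : ℂ) * Complex.I) ^ k / k.factorial * (gauss β x * u x)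
          = (((-2 * Real.pi : ℝ) : ℂ) * Complex.I) ^ k / k.factorial
            * (starRingEnd ℂ ((⟪x, w⟫_ℝ : ℂ) ^ k * gauss β x) * u x) := fun x => by
        simp only [hℓ, map_mul, map_pow, Complex.conj_ofReal, hconj]
        push_cast
        ring
      simp_rw [e]
      rw [integral_const_mul, h1, mul_zero]
    -- The majorants add up to `exp |ℓ x| * ‖gauss β x * u x‖`, integrable as it is bounded by a
    -- product of two `L²` functions.
    have hsum := hasSum_integral_of_dominated_convergence (μ := (volume : Measure Plane))
      (F := fun (k : ℕ) x => ((ℓ x : ℂ) * Complex.I) ^ k / k.factorial * (gauss β x * u x))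
      (f := fun x => Complex.exp (ℓ x * Complex.I) * (gauss β x * u x))
      (fun k x => |ℓ x| ^ k / k.factorial * ‖gauss β x * u x‖) ?_ ?_ ?_ ?_ ?_
    · simp only [hzero] at hsum
      rw [Real.fourier_eq']
      exact hsum.unique hasSum_zero
    · intro k
      refine AEStronglyMeasurable.mul ?_ hi.aestronglyMeasurable
      exact Continuous.aestronglyMeasurable (by fun_prop)
    · intro k
      refine Filter.Eventually.of_forall fun x => le_of_eq ?_
      simp
    · exact Filter.Eventually.of_forall fun x => (Real.summable_pow_div_factorial _).mul_right _
    · have e : ∀ x, ∑' k : ℕ, |ℓ x| ^ k / k.factorial * ‖gauss β x * u x‖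
          = Real.exp |ℓ x| * ‖gauss β x * u x‖ := fun x => by
        rw [tsum_mul_right, Real.exp_eq_exp_ℝ, NormedSpace.exp_eq_tsum_div]
      simp_rw [e]
      have hm := memLp_exp_mul_landauFun hβ (2 * Real.pi * ‖w‖) 0 0
      refine (hm.integrable_mul (Lp.memLp u)).norm.mono' ?_ ?_
      · exact (Continuous.aestronglyMeasurable (by fun_prop)).mul hi.aestronglyMeasurable.norm
      · refine Filter.Eventually.of_forall fun x => ?_
        simp only [landauFun, landauPoly_zero, pow_zero, one_mul, Pi.mul_apply]
        rw [norm_mul, norm_norm, norm_mul, norm_mul, norm_mul, Complex.norm_real, Real.norm_eq_abs,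
          Real.norm_eq_abs, Real.abs_exp, Real.abs_exp, mul_assoc]
        gcongr
        exact hb x
    · refine Filter.Eventually.of_forall fun x => HasSum.mul_right _ ?_
      rw [Complex.exp_eq_exp_ℂ]
      exact NormedSpace.expSeries_div_hasSum_exp _
  refine (Lp.eq_zero_iff_ae_eq_zero).mpr ?_
  filter_upwards [ae_eq_zero_of_fourier_eq_zero hi hF] with x hx
  exact (mul_eq_zero.mp hx).resolve_left (Complex.exp_ne_zero _)

/-! ### The Landau basis and the Fermi projection -/

/-- The normalised Landau eigenfunctions. -/
def landauONB {β : ℝ} (hβ : 0 < β) (p : ℕ × ℕ) : L2 :=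
  ((‖landauVec hβ p.1 p.2‖⁻¹ : ℝ) : ℂ) • landauVec hβ p.1 p.2

theorem norm_sq_landauVec_pos {β : ℝ} (hβ : 0 < β) (n m : ℕ) : 0 < ‖landauVec hβ n m‖ ^ 2 := by
  have := norm_pos_iff.mpr (landauVec_zero_ne_zero hβ)
  rw [norm_sq_landauVec]
  positivity

theorem norm_landauVec_pos {β : ℝ} (hβ : 0 < β) (n m : ℕ) : 0 < ‖landauVec hβ n m‖ :=
  norm_pos_iff.mpr fun h => (norm_sq_landauVec_pos hβ n m).ne' (by rw [h, norm_zero, sq, zero_mul])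

theorem orthonormal_landauONB {β : ℝ} (hβ : 0 < β) : Orthonormal ℂ (landauONB hβ) := by
  refine ⟨fun p => ?_, fun p q hpq => ?_⟩
  · have := norm_landauVec_pos hβ p.1 p.2
    rw [landauONB, norm_smul, Complex.norm_real, norm_inv, norm_norm, inv_mul_cancel₀ this.ne']
  · simp only [landauONB]
    rw [inner_smul_left, inner_smul_right]
    by_cases h : p.1 = q.1
    · rw [inner_landauVec_eq_zero_of_ne_right hβ (fun h' => hpq (Prod.ext h h')), mul_zero,
        mul_zero]
    · rw [inner_landauVec_eq_zero_of_ne_left hβ h, mul_zero, mul_zero]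

/-- The Hilbert basis of Landau eigenfunctions. -/
def landauBasis {β : ℝ} (hβ : 0 < β) : HilbertBasis (ℕ × ℕ) ℂ L2 :=
  HilbertBasis.mkOfOrthogonalEqBot (orthonormal_landauONB hβ) <| by
    rw [Submodule.eq_bot_iff]
    intro u hu
    refine eq_zero_of_inner_landauVec_eq_zero hβ fun n m => ?_
    have h := (Submodule.mem_orthogonal _ _).mp hu _ (Submodule.subset_span ⟨(n, m), rfl⟩)
    rw [landauONB, inner_smul_left] at h
    refine (mul_eq_zero.mp h).resolve_left ?_
    simpa using (norm_pos_iff.mp (norm_landauVec_pos hβ n m))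

theorem landauBasis_apply {β : ℝ} (hβ : 0 < β) (p : ℕ × ℕ) :
    landauBasis hβ p = ((‖landauVec hβ p.1 p.2‖⁻¹ : ℝ) : ℂ) • landauVec hβ p.1 p.2 := by
  rw [landauBasis, HilbertBasis.coe_mkOfOrthogonalEqBot, landauONB]

/-- The pointwise eigenvalue equation is transferred to test functions by formal symmetry. -/
theorem landauVec_mem_landauGraph {B : ℝ} (hB : 0 < B / 2) (n m : ℕ) :
    (landauVec hB n m, ((B * (2 * n + 1) : ℝ) : ℂ) • landauVec hB n m) ∈ landauGraph B := by
  intro ψ h1 h2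
  have e : landauVec hB n m =ᵐ[volume] landauFun (B / 2) n m :=
    (memLp_landauFun hB n m).coeFn_toLp
  have l : ∫ x, starRingEnd ℂ (landauExpr B ψ x) * landauVec hB n m x
      = ∫ x, starRingEnd ℂ (landauExpr B ψ x) * landauFun (B / 2) n m x := by
    refine integral_congr_ae ?_
    filter_upwards [e] with x hx
    rw [hx]
  refine l.trans ?_
  rw [integral_conj_landauExpr_mul B h1 h2 (contDiff_landauFun _ n m)]
  refine integral_congr_ae ?_
  filter_upwards [e, Lp.coeFn_smul ((B * (2 * n + 1) : ℝ) : ℂ) (landauVec hB n m)] with x hx hy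
  rw [hy, Pi.smul_apply, smul_eq_mul, hx, landauExpr_landauFun]

/-- An eigenvector with eigenvalue above `c` is orthogonal to the spectral subspace. -/
theorem inner_eq_zero_of_mem_spectralSubspace {H : Type*} [NormedAddCommGroup H]
    [InnerProductSpace ℂ H] [CompleteSpace H] {A : H →ₗ.[ℂ] H} {c l : ℝ} (hl : c < l) {ψ : H}
    (hψ : (ψ, (l : ℂ) • ψ) ∈ A.graph) {y : H} (hy : y ∈ spectralSubspace A c) :
    ⟪ψ, y⟫_ℂ = 0 := by
  have hle : spectralSubspace A c ≤ (Submodule.span ℂ {ψ})ᗮ := by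
    refine Submodule.topologicalClosure_minimal _ (sSup_le ?_) (Submodule.isClosed_orthogonal _)
    rintro V ⟨_, hr, hf⟩ v hv
    rw [Submodule.mem_orthogonal_singleton_iff_inner_right]
    -- As `V` reduces `A`, the projection of `ψ` to `V` satisfies the same eigenvalue equation; the
    -- form bound `c < l` then forces it to vanish.
    have hQ := hr _ _ hψ
    rw [map_smul] at hQ
    obtain ⟨w, hw1, hw2⟩ := A.mem_graph_iff.mp hQ
    have h1 := hf w (by rw [hw1]; exact Submodule.starProjection_apply_mem _ _)
    rw [hw2, hw1, inner_smul_right, inner_self_eq_norm_sq_to_K, Complex.re_ofReal_mul] at h1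
    have h2 : ((‖V.starProjection ψ‖ : ℂ) ^ 2).re = ‖V.starProjection ψ‖ ^ 2 := by
      norm_cast
    have h3 : l * ‖V.starProjection ψ‖ ^ 2 ≤ c * ‖V.starProjection ψ‖ ^ 2 := by
      rw [← h2]
      exact h1.trans_eq (by rw [h2])
    have h4 : V.starProjection ψ = 0 := by
      by_contra h
      have := norm_pos_iff.mpr h
      have : 0 < ‖V.starProjection ψ‖ ^ 2 := by positivity
      nlinarith
    rw [← Submodule.starProjection_eq_self_iff.mpr hv,
      ← Submodule.inner_starProjection_left_eq_right, h4, inner_zero_left]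
  exact Submodule.mem_orthogonal_singleton_iff_inner_right.mp (hle hy)

theorem inner_landauBasis_fermiProjection {B μ : ℝ} (hB : 0 < B / 2) {p : ℕ × ℕ}
    (hp : μ < B * (2 * p.1 + 1)) (w : L2) :
    ⟪landauBasis hB p, fermiProjection B μ w⟫_ℂ = 0 := by
  have h : ⟪landauVec hB p.1 p.2, fermiProjection B μ w⟫_ℂ = 0 := by
    refine inner_eq_zero_of_mem_spectralSubspace hp ?_ (Submodule.starProjection_apply_mem _ w)
    rw [landauHamiltonian_graph]
    exact landauVec_mem_landauGraph hB p.1 p.2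
  rw [landauBasis_apply, inner_smul_left, h, mul_zero]

/-- A Bessel-type bound for a vector supported on part of a Hilbert basis. -/
theorem norm_sq_le_tsum_of_inner_eq {H ι κ : Type*} [NormedAddCommGroup H] [InnerProductSpace ℂ H]
    (b : HilbertBasis ι ℂ H) {g : κ → ι} (hg : Function.Injective g) {y w : H}
    (hy : ∀ i ∉ Set.range g, ⟪b i, y⟫_ℂ = 0) (hyw : ‖y‖ ^ 2 = (⟪y, w⟫_ℂ).re) :
    ‖y‖ ^ 2 ≤ ∑' j, ‖⟪b (g j), w⟫_ℂ‖ ^ 2 := by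
  have ho : Orthonormal ℂ (b ∘ g) := b.orthonormal.comp g hg
  have h1 : HasSum (fun j => ⟪y, b (g j)⟫_ℂ * ⟪b (g j), w⟫_ℂ) ⟪y, w⟫_ℂ :=
    (hg.hasSum_iff fun i hi => by rw [← inner_conj_symm, hy i hi, map_zero, zero_mul]).mpr
      (b.hasSum_inner_mul_inner y w)
  have h2 := Complex.reCLM.hasSum h1
  have hs1 : Summable fun j => ‖⟪b (g j), y⟫_ℂ‖ ^ 2 := ho.inner_products_summable y
  have hs2 : Summable fun j => ‖⟪b (g j), w⟫_ℂ‖ ^ 2 := ho.inner_products_summable w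
  -- Termwise `ab ≤ (a² + b²) / 2`; the part `‖y‖² / 2` is absorbed into the left side.
  have h3 := hasSum_le (fun j => ?_) h2 ((hs1.hasSum.add hs2.hasSum).mul_left (1 / 2))
  · have h4 : ∑' j, ‖⟪b (g j), y⟫_ℂ‖ ^ 2 ≤ ‖y‖ ^ 2 := ho.tsum_inner_products_le y
    rw [Complex.reCLM_apply, ← hyw] at h3
    linarith
  · have h5 : (⟪y, b (g j)⟫_ℂ * ⟪b (g j), w⟫_ℂ).re
        ≤ ‖⟪b (g j), y⟫_ℂ‖ * ‖⟪b (g j), w⟫_ℂ‖ := by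
      refine (Complex.re_le_norm _).trans_eq ?_
      rw [norm_mul, norm_inner_symm]
    have h6 := two_mul_le_add_sq ‖⟪b (g j), y⟫_ℂ‖ ‖⟪b (g j), w⟫_ℂ‖
    simp only [Complex.reCLM_apply]
    linarith

/-! ### Size of the eigenfunctions on a bounded set. -/

theorem norm_indicatorOp_landauVec_le {β R : ℝ} (hβ : 0 < β) (hR : 1 ≤ R) {Λ : Set Plane}
    (hΛ : MeasurableSet Λ) (hΛR : ∀ x ∈ Λ, ‖x‖ ≤ R) (hvol : volume Λ ≠ ⊤) (n m : ℕ) :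
    ‖indicatorOp Λ hΛ (landauVec hβ n m)‖
      ≤ (β * R + 1) ^ n * (m + 1) ^ n * R ^ m * (volume : Measure Plane).real Λ ^ (1 / 2 : ℝ) := by
  set M := (β * R + 1) ^ n * (m + 1) ^ n * R ^ m with hM
  have hM0 : 0 ≤ M := by
    have : 0 ≤ R := by linarith
    positivity
  have h1 : ‖indicatorOp Λ hΛ (landauVec hβ n m)‖ ≤ ‖indicatorConstLp 2 hΛ hvol (M : ℂ)‖ := by
    refine Lp.norm_le_norm_of_ae_le ?_
    filter_upwards [indicatorOp_apply Λ hΛ (landauVec hβ n m),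
      (memLp_landauFun hβ n m).coeFn_toLp,
      indicatorConstLp_coeFn (p := 2) (hs := hΛ) (hμs := hvol) (c := (M : ℂ))] with x h1 h2 h3
    rw [h1, h3]
    by_cases hx : x ∈ Λ
    · rw [Set.indicator_of_mem hx, Set.indicator_of_mem hx, landauVec, h2, Complex.norm_real,
        Real.norm_of_nonneg hM0, landauFun, norm_mul, norm_gauss]
      refine (mul_le_of_le_one_right (norm_nonneg _) ?_).trans
        (norm_landauPoly_le hβ hR n m (hΛR x hx))
      rw [Real.exp_le_one_iff]
      have : 0 ≤ β / 2 * ‖x‖ ^ 2 := by positivity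
      linarith
    · rw [Set.indicator_of_notMem hx, Set.indicator_of_notMem hx]
  refine h1.trans_eq ?_
  rw [norm_indicatorConstLp two_ne_zero ENNReal.ofNat_ne_top, Complex.norm_real,
    Real.norm_of_nonneg hM0]
  norm_num

/-- Exponential growth on `Λ` divided by `m! / β ^ m` is `O(Y ^ m / m!)`, smaller than any geometric
sequence, uniformly over finitely many levels. -/
theorem norm_sq_indicatorOp_landauBasis_le {β : ℝ} (hβ : 0 < β) {Λ : Set Plane}
    (hΛ : MeasurableSet Λ) (hbdd : Bornology.IsBounded Λ) (N : ℕ) {q : ℝ} (hq : 0 < q) :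
    ∃ K : ℝ, 0 < K ∧ ∀ p : ℕ × ℕ, p.1 ≤ N →
      ‖indicatorOp Λ hΛ (landauBasis hβ p)‖ ^ 2 ≤ K * q ^ p.2 := by
  obtain ⟨R₀, hR₀⟩ := hbdd.exists_norm_le
  set R := max R₀ 1
  have hR : 1 ≤ R := le_max_right _ _
  have hΛR : ∀ x ∈ Λ, ‖x‖ ≤ R := fun x hx => (hR₀ x hx).trans (le_max_left _ _)
  have hvol : volume Λ ≠ ⊤ := hbdd.measure_lt_top.ne
  set D := (volume : Measure Plane).real Λ ^ (1 / 2 : ℝ)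
  have hD : 0 ≤ D := Real.rpow_nonneg measureReal_nonneg _
  -- Gives `δ ^ N ≤ β ^ n * n!` simultaneously for all `n ≤ N`.
  set δ := min β 1
  have hδ : 0 < δ := lt_min hβ one_pos
  set G := ‖landauVec hβ 0 0‖ ^ 2
  have hG : 0 < G := norm_sq_landauVec_pos hβ 0 0
  set A := ((β * R + 1) ^ N * D) ^ 2 / (δ ^ N * G)
  have hA : 0 ≤ A := by positivity
  -- `4 ^ N` comes from squaring `(m + 1) ^ n ≤ (2 ^ N) ^ m`, and `β` from the normalisation.
  set Y := 4 ^ N * R ^ 2 * β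
  have hY : 0 < Y := by positivity
  -- The `1` keeps the constant positive when `Λ` is a null set; the exponential bounds `(Y / q) ^ m
  -- / m!`.
  refine ⟨A * Real.exp (Y / q) + 1, by positivity, fun p hp => ?_⟩
  obtain ⟨n, m⟩ := p
  have hp : n ≤ N := hp
  change ‖indicatorOp Λ hΛ (landauBasis hβ (n, m))‖ ^ 2 ≤ (A * Real.exp (Y / q) + 1) * q ^ m
  have hlow : δ ^ N * G * (m.factorial / β ^ m) ≤ ‖landauVec hβ n m‖ ^ 2 := by
    rw [norm_sq_landauVec]
    have h1 : δ ^ N ≤ β ^ n * n.factorial := by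
      have h2 : δ ^ N ≤ δ ^ n := pow_le_pow_of_le_one hδ.le (min_le_right _ _) hp
      have h3 : δ ^ n ≤ β ^ n := pow_le_pow_left₀ hδ.le (min_le_left _ _) n
      have h4 : (1 : ℝ) ≤ n.factorial := by exact_mod_cast n.factorial_pos
      have h5 : 0 ≤ β ^ n := by positivity
      nlinarith
    have h6 : 0 ≤ (m.factorial : ℝ) / β ^ m * G := by positivity
    have := mul_le_mul_of_nonneg_right h1 h6
    linarith
  have hup : ‖indicatorOp Λ hΛ (landauVec hβ n m)‖
      ≤ (β * R + 1) ^ N * D * (2 ^ N * R) ^ m := by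
    refine (norm_indicatorOp_landauVec_le hβ hR hΛ hΛR hvol n m).trans ?_
    have h1 : (β * R + 1) ^ n ≤ (β * R + 1) ^ N :=
      pow_le_pow_right₀ (by nlinarith) hp
    have h2 : ((m : ℝ) + 1) ^ n ≤ (2 ^ N) ^ m := by
      have h3 : (m : ℝ) + 1 ≤ 2 ^ m := by exact_mod_cast m.lt_two_pow_self
      calc ((m : ℝ) + 1) ^ n ≤ (m + 1) ^ N := pow_le_pow_right₀ (by linarith [m.cast_nonneg (α := ℝ)]) hp
        _ ≤ (2 ^ m) ^ N := by gcongr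
        _ = (2 ^ N) ^ m := by rw [← pow_mul, ← pow_mul, mul_comm]
    calc (β * R + 1) ^ n * (m + 1) ^ n * R ^ m * D
        ≤ (β * R + 1) ^ N * (2 ^ N) ^ m * R ^ m * D := by gcongr
      _ = _ := by rw [mul_pow]; ring
  have hpos := norm_sq_landauVec_pos hβ n m
  have hnorm : ‖indicatorOp Λ hΛ (landauBasis hβ (n, m))‖ ^ 2
      = ‖indicatorOp Λ hΛ (landauVec hβ n m)‖ ^ 2 / ‖landauVec hβ n m‖ ^ 2 := by
    rw [landauBasis_apply, map_smul, norm_smul, Complex.norm_real, norm_inv, norm_norm, mul_pow,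
      inv_pow]
    field_simp
  have hexp : Y ^ m / m.factorial ≤ Real.exp (Y / q) * q ^ m := by
    have := Real.pow_div_factorial_le_exp (Y / q) (by positivity) m
    rw [div_pow, div_div, div_le_iff₀ (by positivity)] at this
    rw [div_le_iff₀ (by positivity)]
    linarith
  calc ‖indicatorOp Λ hΛ (landauBasis hβ (n, m))‖ ^ 2
      ≤ ((β * R + 1) ^ N * D * (2 ^ N * R) ^ m) ^ 2 / (δ ^ N * G * (m.factorial / β ^ m)) := by
        rw [hnorm]
        gcongr
    _ = A * (Y ^ m / m.factorial) := by
        have h4 : (4 : ℝ) ^ N = 2 ^ N * 2 ^ N := by rw [← mul_pow]; norm_num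
        simp only [A, Y, h4]
        field_simp
        ring
    _ ≤ A * (Real.exp (Y / q) * q ^ m) := by gcongr
    _ ≤ (A * Real.exp (Y / q) + 1) * q ^ m := by
        have : 0 < q ^ m := by positivity
        linarith

/-- The form of the localized Fermi projection is dominated by the low Landau levels. -/
theorem re_inner_localFermiProjection_le {B μ : ℝ} (hB : 0 < B / 2) {N : ℕ}
    (hN : ∀ n : ℕ, N < n → μ < B * (2 * n + 1)) (Λ : Set Plane) (hΛ : MeasurableSet Λ) (x : L2) :
    (⟪x, localFermiProjection B μ Λ hΛ x⟫_ℂ).re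
      ≤ ∑' j : ℕ, ‖⟪x, indicatorOp Λ hΛ (landauBasis hB (j % (N + 1), j / (N + 1)))⟫_ℂ‖ ^ 2 := by
  have hs : ∀ x y, ⟪indicatorOp Λ hΛ x, y⟫_ℂ = ⟪x, indicatorOp Λ hΛ y⟫_ℂ :=
    ContinuousLinearMap.isSelfAdjoint_iff_isSymmetric.mp (isSelfAdjoint_indicatorOp Λ hΛ)
  set w := indicatorOp Λ hΛ x
  have hl : (⟪x, localFermiProjection B μ Λ hΛ x⟫_ℂ).re = ‖fermiProjection B μ w‖ ^ 2 := by
    rw [← inner_conj_symm, Complex.conj_re, localFermiProjection_inner, Complex.ofReal_re]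
  have hr : ∀ v, ‖⟪x, indicatorOp Λ hΛ v⟫_ℂ‖ = ‖⟪v, w⟫_ℂ‖ := fun v => by
    rw [← hs, norm_inner_symm]
  simp_rw [hl, hr]
  -- Division with remainder by `N + 1` enumerates the pairs with `n ≤ N`; every other pair lies
  -- above `μ` and is orthogonal to the Fermi range.
  refine norm_sq_le_tsum_of_inner_eq (landauBasis hB)
    (g := fun j : ℕ => (j % (N + 1), j / (N + 1))) ?_ ?_ ?_
  · intro i j hij
    obtain ⟨h1, h2⟩ : i % (N + 1) = j % (N + 1) ∧ i / (N + 1) = j / (N + 1) := Prod.ext_iff.mp hij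
    rw [← Nat.mod_add_div i (N + 1), ← Nat.mod_add_div j (N + 1), h1, h2]
  · rintro ⟨n, m⟩ hp
    refine inner_landauBasis_fermiProjection hB (hN n ?_) w
    by_contra h
    have hn : n < N + 1 := by omega
    refine hp ⟨n + (N + 1) * m, ?_⟩
    beta_reduce
    rw [Nat.add_mul_mod_self_left, Nat.mod_eq_of_lt hn, Nat.add_mul_div_left _ _ (by omega),
      Nat.div_eq_of_lt hn, zero_add]
  · have h1 : ⟪fermiProjection B μ w, w⟫_ℂ
        = ⟪fermiProjection B μ w, fermiProjection B μ w⟫_ℂ := by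
      unfold fermiProjection spectralProjection
      rw [Submodule.inner_starProjection_left_eq_right,
        Submodule.inner_starProjection_left_eq_right,
        Submodule.starProjection_eq_self_iff.mpr (Submodule.starProjection_apply_mem _ _)]
    rw [h1, inner_self_eq_norm_sq_to_K]
    norm_cast

end LandauEntropy

end

theorem mainTheorem6 (B μ : ℝ) (hB : 0 < B) (hμ : B ≤ μ)
    (Λ : Set LandauEntropy.Plane) (hΛ : MeasurableSet Λ) (hbdd : Bornology.IsBounded Λ)
    (α : ℝ) (hα : 0 < α) :
    LandauEntropy.localRenyiEntropy B μ α Λ hΛ < ⊤ := by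
  have hB2 : 0 < B / 2 := by positivity
  obtain ⟨N, hN'⟩ := exists_nat_gt (μ / B)
  have hN : ∀ n : ℕ, N < n → μ < B * (2 * n + 1) := fun n hn => by
    have h1 : (N : ℝ) < n := by exact_mod_cast hn
    rw [div_lt_iff₀ hB] at hN'
    have h2 : (0 : ℝ) ≤ n := n.cast_nonneg
    nlinarith
  obtain ⟨C, γ, hC, hγ0, hγ1, hh⟩ := LandauEntropy.renyiFun_le_rpow hα
  -- The index `m` grows by one only every `N + 1` values of `j`, so ratio `(1 / 2) ^ (N + 1)` in
  -- `m` yields ratio `1 / 2` in `j`.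
  obtain ⟨K, hK, hφ⟩ := LandauEntropy.norm_sq_indicatorOp_landauBasis_le hB2 hΛ hbdd N
    (by positivity : (0 : ℝ) < (1 / 2) ^ (N + 1))
  have hsp := LandauEntropy.spectrum_localFermiProjection B μ Λ hΛ
  refine LandauEntropy.posTrace_cfc_lt_top (LandauEntropy.localFermiProjection_nonneg B μ Λ hΛ)
    hC hγ0 hγ1 ((LandauEntropy.continuousOn_renyiFun hα).mono hsp)
    (fun t ht => LandauEntropy.renyiFun_nonneg hα (hsp ht)) (fun t ht => hh t (hsp ht))
    (fun j => LandauEntropy.indicatorOp Λ hΛ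
      (LandauEntropy.landauBasis hB2 (j % (N + 1), j / (N + 1))))
    (K := K * 2 ^ N) (r := 1 / 2) (by positivity) (by norm_num) (by norm_num) (fun j => ?_)
    (LandauEntropy.re_inner_localFermiProjection_le hB2 hN Λ hΛ)
  refine (hφ (j % (N + 1), j / (N + 1)) (Nat.lt_succ_iff.mp (Nat.mod_lt j N.succ_pos))).trans ?_
  rw [mul_assoc]
  refine mul_le_mul_of_nonneg_left ?_ hK.le
  -- Rounding in the division loses at most `N`, whence the factor `2 ^ N`.
  have h1 : j ≤ (N + 1) * (j / (N + 1)) + N := by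
    have := Nat.mod_add_div j (N + 1)
    have := Nat.lt_succ_iff.mp (Nat.mod_lt j N.succ_pos)
    rw [Nat.succ_eq_add_one] at this
    omega
  have h2 : (1 / 2 : ℝ) ^ ((N + 1) * (j / (N + 1)) + N) ≤ (1 / 2) ^ j :=
    pow_le_pow_of_le_one (by norm_num) (by norm_num) h1
  have h3 : (2 : ℝ) ^ N * (1 / 2) ^ N = 1 := by
    rw [← mul_pow]
    norm_num
  calc ((1 / 2 : ℝ) ^ (N + 1)) ^ (j / (N + 1))
      = 2 ^ N * (1 / 2) ^ ((N + 1) * (j / (N + 1)) + N) := by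
        rw [← pow_mul, pow_add]
        linear_combination -(1 / 2 : ℝ) ^ ((N + 1) * (j / (N + 1))) * h3
    _ ≤ 2 ^ N * (1 / 2) ^ j := by gcongr
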